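/- **Setting.** Let $d\ge 2$ and let $\Omega\subset\mathbb R^d$ be a bounded open set whose boundary is locally a Lipschitz graph. Let $\alpha,\beta\in(0,1)$, and let $F\in C^{2,\beta}(\mathbb R)$ be convex with $F(0)=0$, $F''\le F_0$ on $\mathbb R$ and $-F_0\le F'(t)\le 0$ for $t\le 0$, where $F_0\ge 0$; put $f=-\tfrac12F'$. Let $Q\in C^{0,\beta}(\overline\Omega)$ with $0<Q_{\min}\le Q\le Q_{\max}<\infty$. Let $S\subset\partial\Omega$ be measurable with $\mathcal H^{d-1}(S)>0$, let $u^0\in H^1(\Omega)$, $u^0\ge 0$, and let $\Psi\in C^0(\overline\Omega)\cap C^{2,\alpha}(\Omega)$ satisfy $\Delta\Psi+f(\Psi)\le 0$ and $\Psi>0$ in $\Omega$, and $0\le u^0\le\Psi$ on $S$. Set $$J(u,D)=\int_D|\nabla u|^2+F(u)+Q^2\chi_{\{u>0\}}\,dx,\qquad \mathcal K=\{u\in H^1(\Omega):\ u\le\Psi\ \text{a.e. in }\Omega,\ u=u^0\text{ on }S\},$$ boundary values being understood in the sense of traces. Let $x^0\in\Omega$ and $\delta_0=\operatorname{dist}(x^0,\partial\Omega)$.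 Call $u\in\mathcal K$ a *local minimizer* in $B=B_{\delta_0}(x^0)$ if $J(u,B)\le J(v,B)$ for every open $D\subset\subset B$ and every $v\in\mathcal K\cap(u+H^1_0(D))$. For $0<r<\delta_0$ let $u_{x^0,r}(x)=\tfrac1r u(x^0+rx)$ and let $z_{x^0,r}(x)=|x|\,u_{x^0,r}(x/|x|)$ be its one-homogeneous extension to $B_1$. For $v\in H^1(B_1)$ define (at the scale $r$ and the point $x^0$) $$W(v)=\int_{B_1}|\nabla v|^2+F(rv)+Q^2(x^0+rx)\chi_{\{v>0\}}\,dx-\int_{\partial B_1}v^2\,d\mathcal H^{d-1}.$$ **Proposition.** Let $u\in\mathcal K$ be a local minimizer in $B_{\delta_0}(x^0)$. Then for almost every $r\in(0,\delta_0)$: the functions $u_{x^0,r}$ and $z_{x^0,r}$ belong to $H^1(B_1)$, the boundary integrands below are integrable on $\partial B_1$, the function $\rho\mapsto W(u_{x^0,\rho})$ (with $W$ taken at the scale $\rho$) is differentiable at $r$, and $$\frac{d}{dr}W(u_{x^0,r})=\frac dr\bigl(W(z_{x^0,r})-W(u_{x^0,r})\bigr)+\frac1r\int_{\partial B_1}|x\cdot\nabla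 u_{x^0,r}-u_{x^0,r}|^2\,d\mathcal H^{d-1}+\mathcal F_2(u_{x^0,r};F)+\mathcal Q_2(u_{x^0,r};Q),$$ where $$\mathcal F_2(u_{x^0,r};F)=\frac1r\int_{\partial B_1}F(ru_{x^0,r})\,d\mathcal H^{d-1}-\frac dr\int_{B_1}F(rz_{x^0,r})\,dx,$$ $$\mathcal Q_2(u_{x^0,r};Q)=\frac1r\int_{\partial B_1}Q^2(x^0+rx)\chi_{\{u_{x^0,r}>0\}}\,d\mathcal H^{d-1}-\frac dr\int_{B_1}Q^2(x^0+rx)\chi_{\{z_{x^0,r}>0\}}\,dx.$$ Here $\nabla u_{x^0,r}(x)=(\nabla u)(x^0+rx)$ for any fixed representative of the weak gradient $\nabla u$ (the exceptional null set of $r$ may depend on the representatives of $u$ and $\nabla u$), and the integral $\int_{\partial B_1}v^2$ in $W$ is that of the trace of $v$. -/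

import Mathlib

open MeasureTheory Metric Set Filter Topology
open scoped NNReal ContDiff

noncomputable section

/-- `ℝ^d` with its Euclidean norm. -/
abbrev Eu (d : ℕ) : Type := EuclideanSpace ℝ (Fin d)

/-- Surface measure (the normalised `(d-1)`-dimensional Hausdorff measure) on the unit sphere
`∂B_1` of `ℝ^d`. -/
abbrev surf (d : ℕ) : Measure (sphere (0 : Eu d) 1) := (volume : Measure (Eu d)).toSphere

/-! ### Sobolev functions -/

/-- `G` is a weak (distributional) gradient of `v` in the open set `U`. -/
structure HasWeakGrad {d : ℕ} (U : Set (Eu d)) (v : Eu d → ℝ) (G : Eu d → Eu d) : Prop where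
  locInt : LocallyIntegrableOn v U
  locInt_grad : LocallyIntegrableOn G U
  eq : ∀ φ : Eu d → ℝ, ContDiff ℝ ∞ φ → HasCompactSupport φ → tsupport φ ⊆ U → ∀ e : Eu d,
    ∫ x in U, v x * fderiv ℝ φ x e = - ∫ x in U, φ x * inner ℝ (G x) e

open Classical in
/-- The weak gradient of `v` in `U`, as a function determined up to a null set of `U`
(zero if there is none). -/
def weakGrad {d : ℕ} (U : Set (Eu d)) (v : Eu d → ℝ) : Eu d → Eu d :=
  if h : ∃ G, HasWeakGrad U v G then h.choose else 0

/-- `v ∈ H¹(U)`. -/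
def MemH1 {d : ℕ} (U : Set (Eu d)) (v : Eu d → ℝ) : Prop :=
  MemLp v 2 (volume.restrict U) ∧
    ∃ G : Eu d → Eu d, MemLp G 2 (volume.restrict U) ∧ HasWeakGrad U v G

/-- `w ∈ H¹₀(D)`: `w` is the limit in `H¹(D)` of smooth functions with compact support in `D`. -/
def MemH10 {d : ℕ} (D : Set (Eu d)) (w : Eu d → ℝ) : Prop :=
  MemH1 D w ∧ ∃ φ : ℕ → Eu d → ℝ,
    (∀ n, ContDiff ℝ ∞ (φ n) ∧ HasCompactSupport (φ n) ∧ tsupport (φ n) ⊆ D) ∧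
    Tendsto (fun n => ∫ x in D, ((φ n x - w x) ^ 2 + ‖gradient (φ n) x - weakGrad D w x‖ ^ 2))
      atTop (𝓝 0)

/-- `T` is the trace on `∂B_1` of the function `v ∈ H¹(B_1)`: it is square integrable and
Green's formula holds (the outer normal at `x ∈ ∂B_1` is `x`). -/
def HasSphereTrace {d : ℕ} (v : Eu d → ℝ) (T : sphere (0 : Eu d) 1 → ℝ) : Prop :=
  MemLp T 2 (surf d) ∧ ∀ φ : Eu d → ℝ, ContDiff ℝ ∞ φ → ∀ e : Eu d,
    ∫ x in ball (0 : Eu d) 1,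
        (v x * fderiv ℝ φ x e + φ x * inner ℝ (weakGrad (ball 0 1) v x) e) =
      ∫ x : sphere (0 : Eu d) 1, T x * φ x * inner ℝ (x : Eu d) e ∂(surf d)

open Classical in
/-- The trace of `v ∈ H¹(B_1)` on `∂B_1`, determined up to a null set of `∂B_1`. For `v`
continuous on the closed ball it is the restriction of `v`. -/
def sphereTrace {d : ℕ} (v : Eu d → ℝ) : sphere (0 : Eu d) 1 → ℝ :=
  if h : ∃ T, HasSphereTrace v T then h.choose else 0

/-- `w` has zero trace on the part `S` of the boundary of the Lipschitz domain `Ω`: at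
`ℋ^{d-1}`-almost every point of `S` the mean of `|w|` over `Ω ∩ B_ρ(x)` tends to `0`. (A
Sobolev function on a bounded Lipschitz domain has trace value `c` at `x`, for
`ℋ^{d-1}`-almost every boundary point `x`, exactly if the means of `|w - c|` tend to `0`.) -/
def ZeroTraceOn {d : ℕ} (Ω S : Set (Eu d)) (w : Eu d → ℝ) : Prop :=
  ∀ᵐ x ∂(Measure.hausdorffMeasure ((d : ℝ) - 1) : Measure (Eu d)), x ∈ S →
    Tendsto (fun ρ : ℝ => ⨍ y in Ω ∩ ball x ρ, |w y|) (𝓝[>] 0) (𝓝 0)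

/-! ### The standing assumptions -/

/-- Bounded open set whose boundary is locally the graph of a Lipschitz function `g` over the
hyperplane orthogonal to a unit vector `e`, with the set on one side of the graph. -/
structure IsBoundedLipschitzDomain {d : ℕ} (Ω : Set (Eu d)) : Prop where
  isOpen : IsOpen Ω
  isBounded : Bornology.IsBounded Ω
  graph : ∀ p ∈ frontier Ω, ∃ e : Eu d, ‖e‖ = 1 ∧ ∃ δ > 0, ∃ g : Eu d → ℝ, ∃ L : ℝ≥0,
    LipschitzWith L g ∧ (∀ (x : Eu d) (t : ℝ), g (x + t • e) = g x) ∧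
    ∀ x ∈ ball p δ, (x ∈ Ω ↔ g x < inner ℝ x e)

/-- Assumptions on the nonlinearity: `F ∈ C^{2,β}(ℝ)` is convex, `F'' ≤ F₀`, `F(0) = 0` and
`-F₀ ≤ F'(t) ≤ 0` for `t ≤ 0`. -/
structure IsNonlinearity (F : ℝ → ℝ) (β : ℝ≥0) (F₀ : ℝ) : Prop where
  contDiff : ContDiff ℝ 2 F
  holder : ∀ R : ℝ, ∃ C : ℝ≥0, HolderOnWith C β (deriv (deriv F)) (Icc (-R) R)
  convex : ConvexOn ℝ univ F
  nonneg : 0 ≤ F₀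
  deriv2_le : ∀ t, deriv (deriv F) t ≤ F₀
  zero : F 0 = 0
  deriv_mem : ∀ t ≤ 0, -F₀ ≤ deriv F t ∧ deriv F t ≤ 0

/-- Assumptions on the coefficient: `Q ∈ C^{0,β}(Ω̄)` and `0 < Qmin ≤ Q ≤ Qmax` on `Ω̄`. -/
structure IsCoefficient {d : ℕ} (Ω : Set (Eu d)) (Q : Eu d → ℝ) (β : ℝ≥0) (Qmin Qmax : ℝ) :
    Prop where
  holder : ∃ C : ℝ≥0, HolderOnWith C β Q (closure Ω)
  pos : 0 < Qmin
  bounds : ∀ x ∈ closure Ω, Qmin ≤ Q x ∧ Q x ≤ Qmax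

/-- Assumptions on the Dirichlet part `S ⊆ ∂Ω`, the Dirichlet data `u₀` and the obstacle `Ψ`:
`Ψ ∈ C⁰(Ω̄) ∩ C^{2,α}(Ω)`, `ΔΨ + f(Ψ) ≤ 0` with `f = -F'/2`, `Ψ > 0` in `Ω`, `u₀ ∈ H¹(Ω)`,
`u₀ ≥ 0`, and `0 ≤ u₀ ≤ Ψ` on `S` in the sense of traces. -/
structure IsBoundaryData {d : ℕ} (Ω S : Set (Eu d)) (F : ℝ → ℝ) (Ψ u₀ : Eu d → ℝ) (α : ℝ≥0) :
    Prop where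
  subset : S ⊆ frontier Ω
  meas : NullMeasurableSet S (Measure.hausdorffMeasure ((d : ℝ) - 1) : Measure (Eu d))
  pos_meas : 0 < (Measure.hausdorffMeasure ((d : ℝ) - 1) : Measure (Eu d)) S
  psi_cont : ContinuousOn Ψ (closure Ω)
  psi_contDiff : ContDiffOn ℝ 2 Ψ Ω
  psi_holder : ∀ C : Set (Eu d), IsCompact C → C ⊆ Ω →
    ∃ M : ℝ≥0, HolderOnWith M α (iteratedFDeriv ℝ 2 Ψ) C
  psi_super : ∀ x ∈ Ω, Laplacian.laplacian Ψ x + (-(1 / 2) * deriv F (Ψ x)) ≤ 0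
  psi_pos : ∀ x ∈ Ω, 0 < Ψ x
  u₀_mem : MemH1 Ω u₀
  u₀_nonneg : ∀ᵐ x ∂(volume.restrict Ω), 0 ≤ u₀ x
  u₀_nonneg_S : ZeroTraceOn Ω S (fun x => max (-u₀ x) 0)
  u₀_le_S : ZeroTraceOn Ω S (fun x => max (u₀ x - Ψ x) 0)

/-! ### The functional and its minimizers -/

/-- `J(u, U) = ∫_U |∇u|² + F(u) + Q² χ_{u>0}`. -/
def energyJ {d : ℕ} (F : ℝ → ℝ) (Q : Eu d → ℝ) (U : Set (Eu d)) (u : Eu d → ℝ) : ℝ :=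
  ∫ x in U, (‖weakGrad U u x‖ ^ 2 + F (u x) + {y | 0 < u y}.indicator (fun y => Q y ^ 2) x)

/-- The admissible class `𝒦`: `u ∈ H¹(Ω)`, `u ≤ Ψ` a.e. in `Ω`, `u = u₀` on `S`. -/
def admissible {d : ℕ} (Ω S : Set (Eu d)) (Ψ u₀ : Eu d → ℝ) : Set (Eu d → ℝ) :=
  {u | MemH1 Ω u ∧ (∀ᵐ x ∂(volume.restrict Ω), u x ≤ Ψ x) ∧ ZeroTraceOn Ω S (fun x => u x - u₀ x)}

/-- `u ∈ 𝒦` is a local minimizer of `J` in the open set `B ⊆ Ω`: it minimizes `J(·, B)` among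
the `v ∈ 𝒦` with `v ∈ u + H¹₀(D)` for some open `D ⊂⊂ B`. -/
def IsLocalMinimizer {d : ℕ} (Ω S : Set (Eu d)) (F : ℝ → ℝ) (Q Ψ u₀ : Eu d → ℝ)
    (B : Set (Eu d)) (u : Eu d → ℝ) : Prop :=
  u ∈ admissible Ω S Ψ u₀ ∧
    ∀ D : Set (Eu d), IsOpen D → IsCompact (closure D) → closure D ⊆ B →
      ∀ v ∈ admissible Ω S Ψ u₀, MemH10 D (fun x => v x - u x) →
        (∀ᵐ x ∂(volume.restrict (Ω \ D)), v x = u x) →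
        energyJ F Q B u ≤ energyJ F Q B v

/-! ### The Weiss energy -/

/-- The rescaling `u_{x₀,r}(x) = u(x₀ + r x) / r`. -/
def rescale {d : ℕ} (x₀ : Eu d) (r : ℝ) (u : Eu d → ℝ) : Eu d → ℝ :=
  fun x => 1 / r * u (x₀ + r • x)

/-- The one-homogeneous extension `x ↦ |x| v(x / |x|)`. -/
def oneHomExt {d : ℕ} (v : Eu d → ℝ) : Eu d → ℝ :=
  fun x => ‖x‖ * v (‖x‖⁻¹ • x)

/-- The Weiss energy at the point `x₀` and scale `r` of a function `v ∈ H¹(B_1)`: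
`∫_{B_1} |∇v|² + F(r v) + Q²(x₀ + r x) χ_{v>0} dx - ∫_{∂B_1} v²`. -/
def weissW {d : ℕ} (F : ℝ → ℝ) (Q : Eu d → ℝ) (x₀ : Eu d) (r : ℝ) (v : Eu d → ℝ) : ℝ :=
  (∫ x in ball (0 : Eu d) 1, (‖weakGrad (ball 0 1) v x‖ ^ 2 + F (r * v x) +
      {y | 0 < v y}.indicator (fun y => Q (x₀ + r • y) ^ 2) x)) -
    ∫ x : sphere (0 : Eu d) 1, sphereTrace v x ^ 2 ∂(surf d)

/-- `ℱ₂(v; F) = (1/r) ∫_{∂B_1} F(r v) - (d/r) ∫_{B_1} F(r z)`, `z` the one-homogeneous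
extension of `v`. -/
def corrF {d : ℕ} (F : ℝ → ℝ) (r : ℝ) (v : Eu d → ℝ) : ℝ :=
  1 / r * (∫ x : sphere (0 : Eu d) 1, F (r * v x) ∂(surf d)) -
    d / r * ∫ x in ball (0 : Eu d) 1, F (r * oneHomExt v x)

/-- `𝒬₂(v; Q) = (1/r) ∫_{∂B_1} Q²(x₀ + r x) χ_{v>0} - (d/r) ∫_{B_1} Q²(x₀ + r x) χ_{z>0}`,
`z` the one-homogeneous extension of `v`. -/
def corrQ {d : ℕ} (Q : Eu d → ℝ) (x₀ : Eu d) (r : ℝ) (v : Eu d → ℝ) : ℝ :=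
  1 / r * (∫ x : sphere (0 : Eu d) 1,
      {y : Eu d | 0 < v y}.indicator (fun y => Q (x₀ + r • y) ^ 2) (x : Eu d) ∂(surf d)) -
    d / r * ∫ x in ball (0 : Eu d) 1,
      {y : Eu d | 0 < oneHomExt v y}.indicator (fun y => Q (x₀ + r • y) ^ 2) x

end

/-! The formula is a differentiation in `r` that becomes rigorous once no boundary trace has to be
differentiated. Put the origin at `x₀`, write `v = u(x₀ + ·)` and let `g` be its gradient. Scaling
turns the volume part of `W(u_r)` into `r^(-d) E(r)`, with `E(r)` the integral over `B_r` of
`energyDensity`. By the divergence theorem for the field `v² x`, the boundary part is `r^(-d-2)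
M(r)`, with `M(r)` the integral over `B_r` of `traceDensity`, that is of `d v² + 2 v ∇v·x`. Hence
`W(u_r) = r^(-d) E(r) - r^(-d-2) M(r)` for every `r` (`weissW_rescale_eq`). Polar coordinates and
Lebesgue's differentiation theorem make `E` and `M` differentiable at almost every `r`, with
integrals over `∂B_r` as derivatives (`hasDerivAt_integral_ball`).

The other ingredient is the energy of the one-homogeneous extension `z`. Its gradient is homogeneous
of degree zero, with radial part `u_r` and tangential part that of `∇u_r`, so its Dirichlet integral
is `1/d` times the integral over the sphere of `u_r² + |∇u_r|² - (x·∇u_r)²` (`weissW_oneHomExt_eq`).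
In `(d/r)(W(z) - W(u_r))` the term `-(x·∇u_r)²` cancels against the one in the square `|x·∇u_r -
u_r|²`; what remains is the derivative computed above (`weiss_derivative_algebra`).

The analytic work is to show that, for almost every `r`, the pointwise restriction of `u_r` to the
unit sphere is the trace of both `u_r` and `z`, and that `z` is in `H¹` with the expected gradient
(`ae_greenTriple`). Mollifications with geometrically decreasing errors converge, together with
their gradients, in `L²` of almost every sphere. For a smooth function both claims follow from
Green's formula for Lipschitz functions (`GreenTriple.of_lipschitz`), and Green's formula passes to
`L²` limits (`GreenTriple.of_tendsto`). Since the gradient and trace in `W` are chosen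
noncomputably, uniqueness of both is what connects `W` with these concrete functions. -/

noncomputable section

/-! ### Polar coordinates -/

/-- The surface measure of the unit sphere as a measure on `ℝ^d`. -/
def sphereMeasure (d : ℕ) : Measure (Eu d) := (surf d).map Subtype.val

/-- The measure `s^(d-1) ds` on `(0, R)`. -/
def radialMeasure (d : ℕ) (R : ℝ) : Measure ℝ :=
  (volume.restrict (Ioo 0 R)).withDensity fun s => ENNReal.ofReal (s ^ (d - 1))

lemma measurableEmbedding_sphere (d : ℕ) :
    MeasurableEmbedding (Subtype.val : sphere (0 : Eu d) 1 → Eu d) :=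
  MeasurableEmbedding.subtype_coe isClosed_sphere.measurableSet

instance (d : ℕ) : IsFiniteMeasure (sphereMeasure d) := by
  unfold sphereMeasure; infer_instance

instance (d : ℕ) (R : ℝ) : SFinite (radialMeasure d R) := by
  unfold radialMeasure; infer_instance

lemma ae_norm_sphereMeasure (d : ℕ) : ∀ᵐ θ ∂(sphereMeasure d), ‖θ‖ = 1 := by
  rw [sphereMeasure, (measurableEmbedding_sphere d).ae_map_iff]
  exact ae_of_all _ fun x => by simp

lemma integral_sphereMeasure {d : ℕ} {F : Type*} [NormedAddCommGroup F] [NormedSpace ℝ F]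
    (f : Eu d → F) : ∫ x, f x ∂(sphereMeasure d) = ∫ x : sphere (0 : Eu d) 1, f x ∂(surf d) :=
  (measurableEmbedding_sphere d).integral_map f

lemma integrable_sphereMeasure_iff {d : ℕ} {F : Type*} [NormedAddCommGroup F]
    {f : Eu d → F} : Integrable f (sphereMeasure d) ↔
      Integrable (fun x : sphere (0 : Eu d) 1 => f x) (surf d) :=
  (measurableEmbedding_sphere d).integrable_map_iff

/-- Moves the radial measure from the subtype `Ioi 0` to `ℝ`, so that "almost every radius" can
refer to Lebesgue measure on the line. -/
lemma map_volumeIoiPow (n : ℕ) (R : ℝ) :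
    ((Measure.volumeIoiPow n).map Subtype.val).restrict (Iio R) =
      (volume.restrict (Ioo 0 R)).withDensity fun s => ENNReal.ofReal (s ^ n) := by
  have hm : MeasurableEmbedding (Subtype.val : Ioi (0 : ℝ) → ℝ) :=
    MeasurableEmbedding.subtype_coe measurableSet_Ioi
  ext s hs
  rw [Measure.restrict_apply hs, hm.map_apply, Measure.volumeIoiPow,
    withDensity_apply _ (measurable_subtype_coe (hs.inter measurableSet_Iio)),
    withDensity_apply _ hs, Measure.restrict_restrict hs,
    setLIntegral_subtype measurableSet_Ioi _ fun a : ℝ ↦ .ofReal (a ^ n)]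
  congr 2
  ext x
  simp
  tauto

/-- Polar coordinates as a measure-preserving map out of a product: every later statement about
almost every sphere is Fubini's theorem transported by this map. The origin, which polar coordinates
omit, is a null set. -/
lemma measurePreserving_polar (d : ℕ) [Nontrivial (Eu d)] (R : ℝ) :
    MeasurePreserving (fun p : ℝ × Eu d => p.1 • p.2)
      ((radialMeasure d R).prod (sphereMeasure d)) (volume.restrict (ball 0 R)) := by
  have hmeas : Measurable (fun p : ℝ × Eu d => p.1 • p.2) := by fun_prop
  have h1 : MeasurePreserving (fun q : sphere (0 : Eu d) 1 × Ioi (0 : ℝ) => (q.2 : ℝ) • (q.1 : Eu d))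
      ((surf d).prod (Measure.volumeIoiPow (d - 1))) volume := by
    have h := (volume : Measure (Eu d)).measurePreserving_homeomorphUnitSphereProd
    have h2 := h.symm (homeomorphUnitSphereProd (Eu d)).toMeasurableEquiv
    rw [finrank_euclideanSpace_fin] at h2
    refine ⟨by fun_prop, ?_⟩
    have h3 := h2.map_eq
    have h4 := congrArg (Measure.map Subtype.val) h3
    rw [Measure.map_map measurable_subtype_coe h2.measurable,
      (MeasurableEmbedding.subtype_coe (measurableSet_singleton (0 : Eu d)).compl).map_comap] at h4
    rw [Subtype.range_coe, restrict_compl_singleton] at h4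
    rw [← h4]
    congr 1
  have h2 : MeasurePreserving (fun p : ℝ × Eu d => p.1 • p.2)
      (((Measure.volumeIoiPow (d - 1)).map Subtype.val).prod (sphereMeasure d)) volume := by
    refine ⟨hmeas, ?_⟩
    rw [sphereMeasure, Measure.map_prod_map _ _ measurable_subtype_coe measurable_subtype_coe,
      ← Measure.prod_swap, Measure.map_map (by fun_prop) measurable_swap,
      Measure.map_map hmeas (by fun_prop)]
    exact h1.map_eq
  have h3 := h2.restrict_preimage (measurableSet_ball (x := (0 : Eu d)) (ε := R))
  refine ⟨hmeas, ?_⟩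
  rw [← h3.map_eq]
  congr 1
  rw [radialMeasure, ← map_volumeIoiPow, ← Measure.restrict_univ (μ := sphereMeasure d),
    Measure.prod_restrict, Measure.restrict_univ]
  -- The preimage of the ball equals `{p | p.1 < R}` only almost everywhere: the identity needs
  -- `‖p.2‖ = 1` and `p.1 > 0`.
  refine Measure.restrict_congr_set ?_
  have hq := Measure.quasiMeasurePreserving_snd
    (μ := (Measure.volumeIoiPow (d - 1)).map Subtype.val) (ν := sphereMeasure d)
  have hq1 := Measure.quasiMeasurePreserving_fst
    (μ := (Measure.volumeIoiPow (d - 1)).map Subtype.val) (ν := sphereMeasure d)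
  have hpos : ∀ᵐ s ∂((Measure.volumeIoiPow (d - 1)).map Subtype.val), (0 : ℝ) < s := by
    rw [(MeasurableEmbedding.subtype_coe measurableSet_Ioi).ae_map_iff]
    exact ae_of_all _ fun x => x.2
  rw [eventuallyEq_set]
  filter_upwards [hq.ae (ae_norm_sphereMeasure d), hq1.ae hpos] with p hp hp1
  simp [norm_smul, hp, abs_of_pos hp1]

/-- The density `s^(d-1)` is positive on `(0, R)`, so the radial measure has the same null sets
there as Lebesgue measure. -/
lemma ae_radialMeasure_iff {d : ℕ} {R : ℝ} {p : ℝ → Prop} :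
    (∀ᵐ s ∂(radialMeasure d R), p s) ↔ ∀ᵐ s : ℝ, s ∈ Ioo 0 R → p s := by
  rw [radialMeasure, ae_withDensity_iff (by fun_prop), ← ae_restrict_iff' measurableSet_Ioo]
  refine eventually_congr ?_
  filter_upwards [ae_restrict_mem measurableSet_Ioo] with s hs
  have : 0 < s ^ (d - 1) := pow_pos hs.1 _
  simp [this]

lemma aestronglyMeasurable_sphere_of_ball {d : ℕ} [Nontrivial (Eu d)] {R : ℝ} {F : Type*}
    [NormedAddCommGroup F] {f : Eu d → F}
    (h : AEStronglyMeasurable f (volume.restrict (ball 0 R))) :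
    ∀ᵐ s : ℝ, s ∈ Ioo 0 R → AEStronglyMeasurable (fun θ => f (s • θ)) (sphereMeasure d) := by
  have h1 := h.comp_measurePreserving (measurePreserving_polar d R)
  exact ae_radialMeasure_iff.1 h1.prodMk_left

lemma integrable_polar {d : ℕ} [Nontrivial (Eu d)] {R : ℝ} {F : Type*}
    [NormedAddCommGroup F] {f : Eu d → F} (h : IntegrableOn f (ball 0 R)) :
    Integrable (fun p : ℝ × Eu d => f (p.1 • p.2))
      ((radialMeasure d R).prod (sphereMeasure d)) :=
  (measurePreserving_polar d R).integrable_comp_of_integrable h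

lemma integrable_sphere_of_integrableOn_ball {d : ℕ} [Nontrivial (Eu d)] {R : ℝ} {F : Type*}
    [NormedAddCommGroup F] {f : Eu d → F} (h : IntegrableOn f (ball 0 R)) :
    ∀ᵐ s : ℝ, s ∈ Ioo 0 R → Integrable (fun θ => f (s • θ)) (sphereMeasure d) :=
  ae_radialMeasure_iff.1 (integrable_polar h).prod_right_ae

lemma integrableOn_radial {d : ℕ} [Nontrivial (Eu d)] {R : ℝ} {F : Type*}
    [NormedAddCommGroup F] [NormedSpace ℝ F] {f : Eu d → F} (h : IntegrableOn f (ball 0 R)) :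
    IntegrableOn (fun s : ℝ => s ^ (d - 1) • ∫ θ, f (s • θ) ∂(sphereMeasure d)) (Ioo 0 R) := by
  have h1 := (integrable_polar h).integral_prod_left
  rw [radialMeasure, integrable_withDensity_iff_integrable_smul' (by fun_prop) (by simp)] at h1
  refine h1.congr ?_
  filter_upwards [ae_restrict_mem measurableSet_Ioo] with s hs
  rw [ENNReal.toReal_ofReal (pow_nonneg hs.1.le _)]

lemma integral_ball_eq_polar {d : ℕ} [Nontrivial (Eu d)] {R : ℝ} {F : Type*}
    [NormedAddCommGroup F] [NormedSpace ℝ F] {f : Eu d → F} (h : IntegrableOn f (ball 0 R)) :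
    ∫ x in ball 0 R, f x = ∫ s in Ioo 0 R, s ^ (d - 1) • ∫ θ, f (s • θ) ∂(sphereMeasure d) := by
  have hp := measurePreserving_polar d R
  have h0 : AEStronglyMeasurable f (volume.restrict (ball 0 R)) := h.1
  rw [← hp.map_eq] at h0
  have hi := integrable_polar h
  rw [← hp.map_eq, integral_map hp.measurable.aemeasurable h0,
    integral_prod _ hi, radialMeasure,
    integral_withDensity_eq_integral_toReal_smul (by fun_prop) (by simp)]
  refine setIntegral_congr_fun measurableSet_Ioo fun s hs => ?_
  simp only [ENNReal.toReal_ofReal (pow_nonneg hs.1.le (d - 1))]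

/-- In polar coordinates the integral over `B_ρ` is the primitive of an integrable function of the
radius, so Lebesgue's differentiation theorem applies. -/
lemma hasDerivAt_integral_ball {d : ℕ} [Nontrivial (Eu d)] {R : ℝ} {f : Eu d → ℝ}
    (h : IntegrableOn f (ball 0 R)) :
    ∀ᵐ r : ℝ, r ∈ Ioo 0 R → HasDerivAt (fun ρ => ∫ x in ball 0 ρ, f x)
      (r ^ (d - 1) * ∫ θ, f (r • θ) ∂(sphereMeasure d)) r := by
  rcases le_or_gt R 0 with hR | hR
  · exact ae_of_all _ fun r hr => absurd (hr.1.trans hr.2) (not_lt.2 hR)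
  have hi : IntervalIntegrable
      (fun s : ℝ => s ^ (d - 1) • ∫ θ, f (s • θ) ∂(sphereMeasure d)) volume 0 R :=
    (intervalIntegrable_iff_integrableOn_Ioo_of_le hR.le).2 (integrableOn_radial h)
  filter_upwards [hi.ae_hasDerivAt_integral] with r hr hr'
  have h1 := hr (by rw [uIcc_of_le hR.le]; exact ⟨hr'.1.le, hr'.2.le⟩) 0 (by simp)
  refine h1.congr_of_eventuallyEq ?_
  filter_upwards [Ioo_mem_nhds hr'.1 hr'.2] with ρ hρ
  rw [integral_ball_eq_polar (h.mono_set (ball_subset_ball hρ.2.le)),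
    intervalIntegral.integral_of_le hρ.1.le, integral_Ioc_eq_integral_Ioo]

/-- This mass is the origin of the factor `1/d` in integrals over `B_1` of functions homogeneous of
degree zero. -/
lemma radialMeasure_univ {d : ℕ} (hd : 0 < d) :
    radialMeasure d 1 univ = ENNReal.ofReal (1 / d) := by
  rw [radialMeasure, withDensity_apply _ MeasurableSet.univ, Measure.restrict_univ,
    ← ofReal_integral_eq_lintegral_ofReal]
  · rw [← integral_Ioc_eq_integral_Ioo, ← intervalIntegral.integral_of_le zero_le_one]
    congr 1
    rw [integral_pow, Nat.sub_add_cancel hd]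
    have : ((d - 1 : ℕ) : ℝ) + 1 = d := by
      rw [← Nat.cast_add_one, Nat.sub_add_cancel hd]
    simp [this, hd.ne']
  · exact ((continuous_id.pow _).integrableOn_Icc (a := 0) (b := 1)).mono_set Ioo_subset_Icc_self
  · filter_upwards [ae_restrict_mem measurableSet_Ioo] with s hs using pow_nonneg hs.1.le _

/-- The projection of the unit ball to the unit sphere. -/
lemma map_normalize_ball {d : ℕ} [Nontrivial (Eu d)] (hd : 0 < d) :
    (volume.restrict (ball (0 : Eu d) 1)).map (fun x => ‖x‖⁻¹ • x) =
      ENNReal.ofReal (1 / d) • sphereMeasure d := by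
  have hp := measurePreserving_polar d 1
  rw [← hp.map_eq, Measure.map_map (by fun_prop) hp.measurable, ← radialMeasure_univ hd,
    ← Measure.map_snd_prod]
  refine Measure.map_congr ?_
  have h1 := (Measure.quasiMeasurePreserving_fst (μ := radialMeasure d 1)
    (ν := sphereMeasure d)).ae (ae_radialMeasure_iff.2 (ae_of_all _ fun s hs => hs))
  filter_upwards [h1, (Measure.quasiMeasurePreserving_snd (μ := radialMeasure d 1)
    (ν := sphereMeasure d)).ae (ae_norm_sphereMeasure d)] with p hp1 hp2
  have : p.1 ≠ 0 := hp1.1.ne'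
  simp [norm_smul, hp2, abs_of_pos hp1.1, smul_smul, this]

/-! ### Square integrable functions -/

lemma integrable_inner_of_L2 {X : Type*} [MeasurableSpace X] {μ : Measure X} {F : Type*}
    [NormedAddCommGroup F] [InnerProductSpace ℝ F] {f h : X → F}
    (hf : MemLp f 2 μ) (hh : MemLp h 2 μ) : Integrable (fun x => inner ℝ (f x) (h x)) μ :=
  (hf.norm.integrable_mul hh.norm).mono (hf.1.inner hh.1)
    (ae_of_all _ fun x => by simpa using abs_real_inner_le_norm (f x) (h x))

lemma tendsto_integral_inner_of_L2 {X : Type*} [MeasurableSpace X] {μ : Measure X} {F : Type*}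
    [NormedAddCommGroup F] [InnerProductSpace ℝ F] {f h : ℕ → X → F} {f₀ h₀ : X → F}
    (hf : ∀ n, MemLp (f n) 2 μ) (hf₀ : MemLp f₀ 2 μ) (hh : ∀ n, MemLp (h n) 2 μ)
    (hh₀ : MemLp h₀ 2 μ)
    (tf : Tendsto (fun n => eLpNorm (f n - f₀) 2 μ) atTop (𝓝 0))
    (th : Tendsto (fun n => eLpNorm (h n - h₀) 2 μ) atTop (𝓝 0)) :
    Tendsto (fun n => ∫ x, inner ℝ (f n x) (h n x) ∂μ) atTop (𝓝 (∫ x, inner ℝ (f₀ x) (h₀ x) ∂μ)) := by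
  have h1 := (Lp.tendsto_Lp_iff_tendsto_eLpNorm'' f hf f₀ hf₀).2 tf
  have h2 := (Lp.tendsto_Lp_iff_tendsto_eLpNorm'' h hh h₀ hh₀).2 th
  have h3 := Filter.Tendsto.inner (𝕜 := ℝ) h1 h2
  have key : ∀ (a b : X → F) (ha : MemLp a 2 μ) (hb : MemLp b 2 μ),
      inner ℝ (ha.toLp a) (hb.toLp b) = ∫ x, inner ℝ (a x) (b x) ∂μ := by
    intro a b ha hb
    rw [L2.inner_def]
    refine integral_congr_ae ?_
    filter_upwards [ha.coeFn_toLp, hb.coeFn_toLp] with x hx hy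
    rw [hx, hy]
  simpa only [key] using h3

lemma tendsto_integral_inner_const_of_L2 {X : Type*} [MeasurableSpace X] {μ : Measure X}
    {F : Type*} [NormedAddCommGroup F] [InnerProductSpace ℝ F] {f : ℕ → X → F} {f₀ h : X → F}
    (hf : ∀ n, MemLp (f n) 2 μ) (hf₀ : MemLp f₀ 2 μ) (hh : MemLp h 2 μ)
    (tf : Tendsto (fun n => eLpNorm (f n - f₀) 2 μ) atTop (𝓝 0)) :
    Tendsto (fun n => ∫ x, inner ℝ (f n x) (h x) ∂μ) atTop (𝓝 (∫ x, inner ℝ (f₀ x) (h x) ∂μ)) :=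
  tendsto_integral_inner_of_L2 (h := fun _ => h) hf hf₀ (fun _ => hh) hh tf (by simp)

lemma memLp_two_ball_of_continuous {d : ℕ} {F : Type*} [NormedAddCommGroup F] {f : Eu d → F}
    (hf : Continuous f) (R : ℝ) : MemLp f 2 (volume.restrict (ball 0 R)) := by
  obtain ⟨C, hC⟩ := (isCompact_closedBall (0 : Eu d) R).exists_bound_of_continuousOn hf.continuousOn
  have : IsFiniteMeasure (volume.restrict (ball (0 : Eu d) R)) :=
    ⟨by simpa using measure_ball_lt_top⟩
  refine MemLp.of_bound hf.aestronglyMeasurable C ?_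
  filter_upwards [ae_restrict_mem measurableSet_ball] with x hx
  exact hC x (ball_subset_closedBall hx)

lemma memLp_two_sphere_of_continuous {d : ℕ} {F : Type*} [NormedAddCommGroup F] {f : Eu d → F}
    (hf : Continuous f) : MemLp f 2 (sphereMeasure d) := by
  obtain ⟨C, hC⟩ := (isCompact_sphere (0 : Eu d) 1).exists_bound_of_continuousOn hf.continuousOn
  refine MemLp.of_bound hf.aestronglyMeasurable C ?_
  filter_upwards [ae_norm_sphereMeasure d] with x hx
  exact hC x (by simpa using hx)

lemma memLp_sphereMeasure_iff {d : ℕ} {F : Type*} [NormedAddCommGroup F] {f : Eu d → F}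
    {p : ENNReal} :
    MemLp f p (sphereMeasure d) ↔ MemLp (fun x : sphere (0 : Eu d) 1 => f x) p (surf d) :=
  (measurableEmbedding_sphere d).memLp_map_measure_iff

/-! ### Uniqueness of weak gradients and traces -/

/-- The fundamental lemma of the calculus of variations for the vector-valued function `G - G'`;
pairing with each `e` reduces its hypothesis to the scalar identities of the definition. -/
lemma HasWeakGrad.ae_eq {d : ℕ} {U : Set (Eu d)} (hU : IsOpen U) {v : Eu d → ℝ}
    {G G' : Eu d → Eu d} (h : HasWeakGrad U v G) (h' : HasWeakGrad U v G') :
    G =ᵐ[volume.restrict U] G' := by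
  have key := hU.ae_eq_zero_of_integral_contDiff_smul_eq_zero (μ := volume)
    (h.locInt_grad.sub h'.locInt_grad) (fun φ hφ hc hs => by
    have hint : ∀ {H : Eu d → Eu d}, LocallyIntegrableOn H U →
        IntegrableOn (fun x => φ x • H x) U := by
      intro H hH
      have h1 := (hH.integrableOn_compact_subset hs hc).continuousOn_smul
        hφ.continuous.continuousOn hc
      refine (h1.integrable_of_forall_notMem_eq_zero fun x hx => ?_).integrableOn
      rw [image_eq_zero_of_notMem_tsupport hx, zero_smul]
    rw [← setIntegral_eq_integral_of_forall_compl_eq_zero (s := U) (fun x hx => by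
      rw [image_eq_zero_of_notMem_tsupport (fun hx' => hx (hs hx')), zero_smul])]
    simp only [Pi.sub_apply, smul_sub]
    rw [integral_sub (hint h.locInt_grad) (hint h'.locInt_grad), sub_eq_zero]
    refine ext_inner_left ℝ fun e => ?_
    rw [← integral_inner (hint h.locInt_grad), ← integral_inner (hint h'.locInt_grad)]
    have e1 := h.eq φ hφ hc hs e
    have e2 := h'.eq φ hφ hc hs e
    rw [e1] at e2
    simpa only [inner_smul_right, real_inner_comm] using neg_injective e2)
  rw [EventuallyEq, ae_restrict_iff' hU.measurableSet]
  filter_upwards [key] with x hx hxU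
  exact sub_eq_zero.1 (hx hxU)

lemma HasWeakGrad.weakGrad_ae_eq {d : ℕ} {U : Set (Eu d)} (hU : IsOpen U) {v : Eu d → ℝ}
    {G : Eu d → Eu d} (h : HasWeakGrad U v G) :
    weakGrad U v =ᵐ[volume.restrict U] G := by
  have hex : ∃ G, HasWeakGrad U v G := ⟨G, h⟩
  rw [weakGrad, dif_pos hex]
  exact HasWeakGrad.ae_eq hU hex.choose_spec h

/-- The weight `inner x e` vanishes on a great sphere, so no single `e` suffices. Testing with `φ
x_i` in the direction `e_i` and summing over `i` gives the weight `∑ x_i² = 1`, which leaves the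
integral of `φ T`. -/
lemma ae_eq_of_integral_sphere_eq {d : ℕ} {T T' : Eu d → ℝ} (hT : MemLp T 2 (sphereMeasure d))
    (hT' : MemLp T' 2 (sphereMeasure d))
    (h : ∀ φ : Eu d → ℝ, ContDiff ℝ ∞ φ → ∀ e : Eu d,
      ∫ x, T x * φ x * inner ℝ x e ∂(sphereMeasure d) =
        ∫ x, T' x * φ x * inner ℝ x e ∂(sphereMeasure d)) :
    T =ᵐ[sphereMeasure d] T' := by
  have key : ∀ {S : Eu d → ℝ}, MemLp S 2 (sphereMeasure d) → ∀ φ : Eu d → ℝ, ContDiff ℝ ∞ φ →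
      ∫ x, φ x * S x ∂(sphereMeasure d) = ∑ i : Fin d, ∫ x, S x * (φ x * x i) *
        inner ℝ x (EuclideanSpace.single i (1 : ℝ)) ∂(sphereMeasure d) := by
    intro S hS φ hφ
    rw [← integral_finsetSum]
    · refine integral_congr_ae ?_
      filter_upwards [ae_norm_sphereMeasure d] with x hx
      have h1 : ∑ i, x i ^ 2 = 1 := by
        have := EuclideanSpace.real_norm_sq_eq x
        rw [← this, hx, one_pow]
      simp only [EuclideanSpace.inner_single_right, one_mul, conj_trivial, mul_assoc]
      rw [← Finset.mul_sum, ← Finset.mul_sum]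
      simp only [← pow_two, h1, mul_one]
      ring
    · intro i _
      simp only [mul_assoc]
      have h2 : MemLp (fun x : Eu d => φ x * (x i * inner ℝ x (EuclideanSpace.single i (1 : ℝ))))
          2 (sphereMeasure d) := memLp_two_sphere_of_continuous
            (by have := hφ.continuous; fun_prop)
      exact hS.integrable_mul h2
  refine ae_eq_of_integral_contDiff_smul_eq (hT.integrable one_le_two).locallyIntegrable
    (hT'.integrable one_le_two).locallyIntegrable fun φ hφ _ => ?_
  simp only [smul_eq_mul]
  rw [key hT φ hφ, key hT' φ hφ]
  refine Finset.sum_congr rfl fun i _ => ?_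
  have hi : ContDiff ℝ ∞ fun x : Eu d => x i := by fun_prop
  exact h _ (hφ.mul hi) _

/-! ### Green's formula -/

/-- `v` is square integrable in the unit ball with square integrable gradient `g` and square
integrable trace `T`, in the sense that Green's formula holds. -/
structure GreenTriple {d : ℕ} (v : Eu d → ℝ) (g : Eu d → Eu d) (T : Eu d → ℝ) : Prop where
  memLp : MemLp v 2 (volume.restrict (ball 0 1))
  memLp_grad : MemLp g 2 (volume.restrict (ball 0 1))
  memLp_trace : MemLp T 2 (sphereMeasure d)
  green : ∀ φ : Eu d → ℝ, ContDiff ℝ ∞ φ → ∀ e : Eu d,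
    ∫ x in ball (0 : Eu d) 1, (v x * fderiv ℝ φ x e + φ x * inner ℝ (g x) e) =
      ∫ x, T x * φ x * inner ℝ x e ∂(sphereMeasure d)

lemma continuous_fderiv_apply_const {d : ℕ} {φ : Eu d → ℝ} (hφ : ContDiff ℝ ∞ φ) (e : Eu d) :
    Continuous fun x => fderiv ℝ φ x e :=
  (hφ.continuous_fderiv (by simp)).clm_apply continuous_const

lemma isFiniteMeasure_restrict_ball (d : ℕ) (R : ℝ) :
    IsFiniteMeasure (volume.restrict (ball (0 : Eu d) R)) :=
  ⟨by simpa using measure_ball_lt_top⟩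

lemma integral_green_split {d : ℕ} {v : Eu d → ℝ} {g : Eu d → Eu d}
    (hv : MemLp v 2 (volume.restrict (ball 0 1))) (hg : MemLp g 2 (volume.restrict (ball 0 1)))
    {φ : Eu d → ℝ} (hφ : ContDiff ℝ ∞ φ) (e : Eu d) :
    ∫ x in ball (0 : Eu d) 1, (v x * fderiv ℝ φ x e + φ x * inner ℝ (g x) e) =
      (∫ x in ball (0 : Eu d) 1, inner ℝ (v x) (fderiv ℝ φ x e)) +
        ∫ x in ball (0 : Eu d) 1, inner ℝ (g x) (φ x • e) := by
  have h1 : MemLp (fun x => fderiv ℝ φ x e) 2 (volume.restrict (ball 0 1)) :=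
    memLp_two_ball_of_continuous (continuous_fderiv_apply_const hφ e) 1
  have h2 : MemLp (fun x => φ x • e) 2 (volume.restrict (ball 0 1)) :=
    memLp_two_ball_of_continuous (hφ.continuous.smul continuous_const) 1
  rw [← integral_add (integrable_inner_of_L2 hv h1) (integrable_inner_of_L2 hg h2)]
  refine integral_congr_ae (ae_of_all _ fun x => ?_)
  simp only [inner_smul_right]
  simp [mul_comm]

/-- For fixed `φ` and `e` each term of Green's formula is an `L²` pairing of `v`, `g` or `T` with a
fixed bounded function, hence continuous under `L²` convergence. -/
lemma GreenTriple.of_tendsto {d : ℕ} {v : ℕ → Eu d → ℝ} {g : ℕ → Eu d → Eu d}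
    {T : ℕ → Eu d → ℝ} (h : ∀ n, GreenTriple (v n) (g n) (T n)) {v₀ : Eu d → ℝ}
    {g₀ : Eu d → Eu d} {T₀ : Eu d → ℝ} (hv : MemLp v₀ 2 (volume.restrict (ball 0 1)))
    (hg : MemLp g₀ 2 (volume.restrict (ball 0 1))) (hT : MemLp T₀ 2 (sphereMeasure d))
    (tv : Tendsto (fun n => eLpNorm (v n - v₀) 2 (volume.restrict (ball 0 1))) atTop (𝓝 0))
    (tg : Tendsto (fun n => eLpNorm (g n - g₀) 2 (volume.restrict (ball 0 1))) atTop (𝓝 0))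
    (tT : Tendsto (fun n => eLpNorm (T n - T₀) 2 (sphereMeasure d)) atTop (𝓝 0)) :
    GreenTriple v₀ g₀ T₀ := by
  refine ⟨hv, hg, hT, fun φ hφ e => ?_⟩
  have h1 : MemLp (fun x => fderiv ℝ φ x e) 2 (volume.restrict (ball 0 1)) :=
    memLp_two_ball_of_continuous (continuous_fderiv_apply_const hφ e) 1
  have h2 : MemLp (fun x => φ x • e) 2 (volume.restrict (ball 0 1)) :=
    memLp_two_ball_of_continuous (hφ.continuous.smul continuous_const) 1
  have h3 : MemLp (fun x => inner ℝ x e * φ x) 2 (sphereMeasure d) :=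
    memLp_two_sphere_of_continuous
      ((continuous_id.inner continuous_const).mul hφ.continuous)
  have l1 := tendsto_integral_inner_const_of_L2 (fun n => (h n).memLp) hv h1 tv
  have l2 := tendsto_integral_inner_const_of_L2 (fun n => (h n).memLp_grad) hg h2 tg
  have l3 := tendsto_integral_inner_const_of_L2 (fun n => (h n).memLp_trace) hT h3 tT
  have l4 := l1.add l2
  have hn : ∀ n, _ := fun n => (h n).green φ hφ e
  simp only [integral_green_split (h _).memLp (h _).memLp_grad hφ e] at hn
  rw [integral_green_split hv hg hφ e]
  have e3 : ∀ S : Eu d → ℝ, ∫ x, inner ℝ (S x) (inner ℝ x e * φ x) ∂(sphereMeasure d) =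
      ∫ x, S x * φ x * inner ℝ x e ∂(sphereMeasure d) := fun S =>
    integral_congr_ae (ae_of_all _ fun x => by simp; ring)
  simp only [e3, ← hn] at l3
  exact tendsto_nhds_unique l4 l3

/-- A test function supported in the open ball vanishes on the sphere, so the boundary term drops
out. -/
lemma GreenTriple.hasWeakGrad {d : ℕ} {v : Eu d → ℝ} {g : Eu d → Eu d} {T : Eu d → ℝ}
    (h : GreenTriple v g T) : HasWeakGrad (ball 0 1) v g := by
  have := isFiniteMeasure_restrict_ball d 1
  refine ⟨?_, ?_, fun φ hφ hc hs e => ?_⟩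
  · have : IntegrableOn v (ball 0 1) := h.memLp.integrable one_le_two
    exact this.locallyIntegrableOn
  · have : IntegrableOn g (ball 0 1) := h.memLp_grad.integrable one_le_two
    exact this.locallyIntegrableOn
  · have h0 := h.green φ hφ e
    have hz : ∫ x, T x * φ x * inner ℝ x e ∂(sphereMeasure d) = 0 := by
      refine integral_eq_zero_of_ae ?_
      filter_upwards [ae_norm_sphereMeasure d] with x hx
      have : φ x = 0 := image_eq_zero_of_notMem_tsupport fun hx' => by
        have := hs hx'
        simp [hx] at this
      simp [this]
    rw [hz, integral_green_split h.memLp h.memLp_grad hφ e] at h0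
    have e1 : ∀ x, inner ℝ (v x) (fderiv ℝ φ x e) = v x * fderiv ℝ φ x e := fun x => by
      simp [mul_comm]
    have e2 : ∀ x, inner ℝ (g x) (φ x • e) = φ x * inner ℝ (g x) e := fun x => by
      rw [inner_smul_right]
    simp only [e1, e2] at h0
    linarith

lemma GreenTriple.memH1 {d : ℕ} {v : Eu d → ℝ} {g : Eu d → Eu d} {T : Eu d → ℝ}
    (h : GreenTriple v g T) : MemH1 (ball 0 1) v :=
  ⟨h.memLp, g, h.memLp_grad, h.hasWeakGrad⟩

lemma GreenTriple.weakGrad_ae_eq {d : ℕ} {v : Eu d → ℝ} {g : Eu d → Eu d} {T : Eu d → ℝ}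
    (h : GreenTriple v g T) : weakGrad (ball 0 1) v =ᵐ[volume.restrict (ball 0 1)] g :=
  h.hasWeakGrad.weakGrad_ae_eq isOpen_ball

lemma GreenTriple.hasSphereTrace {d : ℕ} {v : Eu d → ℝ} {g : Eu d → Eu d} {T : Eu d → ℝ}
    (h : GreenTriple v g T) : HasSphereTrace v (fun x => T x) := by
  refine ⟨memLp_sphereMeasure_iff.1 h.memLp_trace, fun φ hφ e => ?_⟩
  rw [← integral_sphereMeasure (fun x => T x * φ x * inner ℝ x e), ← h.green φ hφ e]
  refine integral_congr_ae ?_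
  filter_upwards [h.weakGrad_ae_eq] with x hx
  rw [hx]

/-- Both traces satisfy Green's formula with the same left side. They live on the sphere as a
subtype, so they are extended by zero to `ℝ^d` to compare them under `sphereMeasure`. -/
lemma HasSphereTrace.ae_eq {d : ℕ} {v : Eu d → ℝ} {T T' : sphere (0 : Eu d) 1 → ℝ}
    (h : HasSphereTrace v T) (h' : HasSphereTrace v T') : T =ᵐ[surf d] T' := by
  have he := measurableEmbedding_sphere d
  have hext : ∀ S : sphere (0 : Eu d) 1 → ℝ,
      (fun x : sphere (0 : Eu d) 1 => Function.extend Subtype.val S 0 (x : Eu d)) = S :=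
    fun S => funext fun x => Subtype.val_injective.extend_apply S 0 x
  have hmem : ∀ S : sphere (0 : Eu d) 1 → ℝ, MemLp S 2 (surf d) →
      MemLp (Function.extend Subtype.val S 0) 2 (sphereMeasure d) := fun S hS => by
    rw [memLp_sphereMeasure_iff, hext]; exact hS
  have key := ae_eq_of_integral_sphere_eq (hmem T h.1) (hmem T' h'.1) fun φ hφ e => by
    rw [integral_sphereMeasure, integral_sphereMeasure]
    simp only [Subtype.val_injective.extend_apply]
    rw [← h.2 φ hφ e, ← h'.2 φ hφ e]
  rw [EventuallyEq, sphereMeasure, he.ae_map_iff] at key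
  filter_upwards [key] with x hx
  simpa only [Subtype.val_injective.extend_apply] using hx

lemma GreenTriple.sphereTrace_ae_eq {d : ℕ} {v : Eu d → ℝ} {g : Eu d → Eu d} {T : Eu d → ℝ}
    (h : GreenTriple v g T) : sphereTrace v =ᵐ[surf d] fun x => T x := by
  have hex : ∃ T, HasSphereTrace v T := ⟨_, h.hasSphereTrace⟩
  rw [sphereTrace, dif_pos hex]
  exact hex.choose_spec.ae_eq h.hasSphereTrace

lemma GreenTriple.trace_ae_eq {d : ℕ} {v : Eu d → ℝ} {g g' : Eu d → Eu d} {T T' : Eu d → ℝ}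
    (h : GreenTriple v g T) (h' : GreenTriple v g' T') : T =ᵐ[sphereMeasure d] T' := by
  rw [EventuallyEq, sphereMeasure, (measurableEmbedding_sphere d).ae_map_iff]
  exact h.hasSphereTrace.ae_eq h'.hasSphereTrace

/-- The Weiss energy in terms of a gradient and a trace. -/
lemma GreenTriple.weissW_eq {d : ℕ} {v : Eu d → ℝ} {g : Eu d → Eu d} {T : Eu d → ℝ}
    (h : GreenTriple v g T) (F : ℝ → ℝ) (Q : Eu d → ℝ) (x₀ : Eu d) (r : ℝ) :
    weissW F Q x₀ r v =
      (∫ x in ball (0 : Eu d) 1, (‖g x‖ ^ 2 + F (r * v x) +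
        {y | 0 < v y}.indicator (fun y => Q (x₀ + r • y) ^ 2) x)) -
      ∫ x, T x ^ 2 ∂(sphereMeasure d) := by
  rw [weissW, integral_sphereMeasure]
  congr 1
  · refine integral_congr_ae ?_
    filter_upwards [h.weakGrad_ae_eq] with x hx
    rw [hx]
  · refine integral_congr_ae ?_
    filter_upwards [h.sphereTrace_ae_eq] with x hx
    rw [hx]

/-! ### Green's formula for Lipschitz functions -/

lemma hasFDerivAt_norm_of_ne_zero {d : ℕ} {x : Eu d} (hx : x ≠ 0) :
    HasFDerivAt (fun y : Eu d => ‖y‖) (‖x‖⁻¹ • innerSL ℝ x) x := by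
  have h := (hasStrictFDerivAt_norm_sq x).hasFDerivAt.sqrt (by simpa using hx)
  simp only [Real.sqrt_sq (norm_nonneg _)] at h
  refine h.congr_fderiv ?_
  ext e
  have hn : ‖x‖ ≠ 0 := norm_ne_zero_iff.2 hx
  simp only [smul_apply, smul_eq_mul, nsmul_eq_mul, innerSL_apply_apply,
    Nat.cast_ofNat]
  field_simp

/-- This cutoff is chosen because its gradient is exactly `-x/|x|` in `B_R` and zero outside:
integrating by parts against it produces the normal component of `e` on each sphere. -/
lemma lipschitzWith_cutoff (d : ℕ) (R : ℝ) :
    LipschitzWith 1 (fun x : Eu d => max (R - ‖x‖) 0) := by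
  refine LipschitzWith.of_dist_le_mul fun x y => ?_
  have h1 := abs_max_sub_max_le_abs (R - ‖x‖) (R - ‖y‖) 0
  rw [NNReal.coe_one, one_mul, Real.dist_eq, dist_eq_norm]
  refine h1.trans ?_
  have : R - ‖x‖ - (R - ‖y‖) = -(‖x‖ - ‖y‖) := by ring
  rw [this, abs_neg]
  exact abs_norm_sub_norm_le x y

lemma hasCompactSupport_cutoff (d : ℕ) (R : ℝ) :
    HasCompactSupport (fun x : Eu d => max (R - ‖x‖) 0) := by
  refine HasCompactSupport.of_support_subset_isCompact (isCompact_closedBall (0 : Eu d) R) ?_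
  intro x hx
  by_contra h
  refine hx (max_eq_right ?_)
  simp only [mem_closedBall, dist_zero_right, not_le] at h
  linarith

lemma ae_ne_zero_and_norm_ne (d : ℕ) [Nontrivial (Eu d)] (R : ℝ) :
    ∀ᵐ x : Eu d, x ≠ 0 ∧ ‖x‖ ≠ R := by
  have h1 : ∀ᵐ x : Eu d, x ≠ 0 := Measure.ae_ne volume 0
  have h2 : ∀ᵐ x : Eu d, x ∉ sphere (0 : Eu d) R :=
    measure_eq_zero_iff_ae_notMem.1 (Measure.addHaar_sphere volume (0 : Eu d) R)
  filter_upwards [h1, h2] with x hx hx2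
  exact ⟨hx, by simpa using hx2⟩

lemma lineDeriv_cutoff {d : ℕ} {R : ℝ} {x : Eu d} (hx : x ≠ 0) (hxR : ‖x‖ ≠ R) (e : Eu d) :
    lineDeriv ℝ (fun x : Eu d => max (R - ‖x‖) 0) x (-e) =
      (ball (0 : Eu d) R).indicator (fun x => inner ℝ (‖x‖⁻¹ • x) e) x := by
  rcases lt_or_gt_of_ne hxR with h | h
  · rw [indicator_of_mem (by simpa using h)]
    have h1 : HasFDerivAt (fun x : Eu d => max (R - ‖x‖) 0) (-(‖x‖⁻¹ • innerSL ℝ x)) x := by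
      refine ((hasFDerivAt_norm_of_ne_zero hx).const_sub R).congr_of_eventuallyEq ?_
      filter_upwards [(continuous_norm.tendsto x).eventually (gt_mem_nhds h)] with y hy
      exact max_eq_left (by linarith)
    rw [(h1.hasLineDerivAt (-e)).lineDeriv]
    simp [inner_smul_left]
  · rw [indicator_of_notMem (by simpa using h.le)]
    have h1 : HasFDerivAt (fun x : Eu d => max (R - ‖x‖) 0) (0 : Eu d →L[ℝ] ℝ) x := by
      refine (hasFDerivAt_const (0 : ℝ) x).congr_of_eventuallyEq ?_
      filter_upwards [(continuous_norm.tendsto x).eventually (lt_mem_nhds h)] with y hy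
      exact max_eq_right (by linarith)
    rw [(h1.hasLineDerivAt (-e)).lineDeriv]
    simp

lemma integral_lineDeriv_mul_cutoff {d : ℕ} [Nontrivial (Eu d)] {f : Eu d → ℝ} {C : ℝ≥0}
    (hf : LipschitzWith C f) (e : Eu d) (R : ℝ) :
    ∫ x, lineDeriv ℝ f x e * max (R - ‖x‖) 0 =
      ∫ x in ball 0 R, inner ℝ (‖x‖⁻¹ • x) e * f x := by
  rw [hf.integral_lineDeriv_mul_eq (lipschitzWith_cutoff d R) (hasCompactSupport_cutoff d R),
    ← integral_indicator measurableSet_ball]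
  refine integral_congr_ae ?_
  filter_upwards [ae_ne_zero_and_norm_ne d R] with x hx
  rw [lineDeriv_cutoff hx.1 hx.2, indicator_mul_left]

lemma integral_lineDeriv_mul_cutoff_eq_radial {d : ℕ} [Nontrivial (Eu d)] {f : Eu d → ℝ}
    {C : ℝ≥0} (hf : LipschitzWith C f) (e : Eu d) {R : ℝ} (hR : 0 ≤ R) :
    ∫ x, lineDeriv ℝ f x e * max (R - ‖x‖) 0 =
      ∫ s in (0 : ℝ)..R, s ^ (d - 1) * ∫ θ, inner ℝ θ e * f (s • θ) ∂(sphereMeasure d) := by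
  have hint : IntegrableOn (fun x : Eu d => inner ℝ (‖x‖⁻¹ • x) e * f x) (ball 0 R) := by
    have := isFiniteMeasure_restrict_ball d R
    have h1 : Integrable f (volume.restrict (ball 0 R)) :=
      (memLp_two_ball_of_continuous hf.continuous R).integrable one_le_two
    refine h1.bdd_mul (c := ‖e‖) (by fun_prop) ?_
    filter_upwards with x
    refine (norm_inner_le_norm _ _).trans ?_
    have : ‖‖x‖⁻¹ • x‖ ≤ 1 := by
      rw [norm_smul, norm_inv, norm_norm]
      exact inv_mul_le_one
    exact mul_le_of_le_one_left (norm_nonneg _) this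
  rw [integral_lineDeriv_mul_cutoff hf, integral_ball_eq_polar hint,
    intervalIntegral.integral_of_le hR, integral_Ioc_eq_integral_Ioo]
  refine setIntegral_congr_fun measurableSet_Ioo fun s hs => ?_
  simp only [smul_eq_mul]
  congr 1
  refine integral_congr_ae ?_
  filter_upwards [ae_norm_sphereMeasure d] with θ hθ
  simp [norm_smul, hθ, abs_of_pos hs.1, smul_smul, hs.1.ne']

lemma continuous_sphere_average {d : ℕ} {f : Eu d → ℝ} (hf : Continuous f) (e : Eu d) :
    Continuous fun s : ℝ =>
      s ^ (d - 1) * ∫ θ, inner ℝ θ e * f (s • θ) ∂(sphereMeasure d) := by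
  refine (continuous_id.pow _).mul (continuous_iff_continuousAt.2 fun s₀ => ?_)
  obtain ⟨C, hC⟩ := (isCompact_closedBall (0 : Eu d) (|s₀| + 1)).exists_bound_of_continuousOn
    hf.continuousOn
  refine continuousAt_of_dominated (bound := fun _ => ‖e‖ * C) ?_ ?_ (integrable_const _) ?_
  · exact Eventually.of_forall fun s => Continuous.aestronglyMeasurable (by fun_prop)
  · filter_upwards [ball_mem_nhds s₀ one_pos] with s hs
    filter_upwards [ae_norm_sphereMeasure d] with θ hθ
    rw [norm_mul]
    refine mul_le_mul ?_ (hC _ ?_) (norm_nonneg _) (norm_nonneg _)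
    · simpa [hθ] using norm_inner_le_norm (𝕜 := ℝ) θ e
    · have h1 : |s| - |s₀| ≤ |s - s₀| := abs_sub_abs_le_abs_sub s s₀
      rw [mem_ball, Real.dist_eq] at hs
      simp only [mem_closedBall, dist_zero_right, norm_smul, hθ, mul_one, Real.norm_eq_abs]
      linarith
  · exact ae_of_all _ fun θ => by fun_prop

lemma tendsto_cutoff_quotient {d : ℕ} {x : Eu d} (hx : ‖x‖ ≠ 1) :
    Tendsto (fun t : ℝ => t⁻¹ * (max (1 + t - ‖x‖) 0 - max (1 - ‖x‖) 0)) (𝓝[>] 0)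
      (𝓝 ((ball (0 : Eu d) 1).indicator (fun _ => 1) x)) := by
  rcases lt_or_gt_of_ne hx with h | h
  · rw [indicator_of_mem (by simpa using h)]
    refine tendsto_const_nhds.congr' ?_
    filter_upwards [self_mem_nhdsWithin] with t ht
    rw [mem_Ioi] at ht
    rw [max_eq_left (by linarith), max_eq_left (by linarith)]
    field_simp
    ring
  · rw [indicator_of_notMem (by simpa using h.le)]
    refine tendsto_const_nhds.congr' ?_
    have : ∀ᶠ t : ℝ in 𝓝[>] 0, t < ‖x‖ - 1 :=
      nhdsWithin_le_nhds (gt_mem_nhds (by linarith))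
    filter_upwards [this] with t ht
    rw [max_eq_right (by linarith), max_eq_right (by linarith)]
    simp

/-- The divergence theorem in the unit ball for Lipschitz functions. -/
lemma integral_lineDeriv_ball {d : ℕ} [Nontrivial (Eu d)] {f : Eu d → ℝ} {C : ℝ≥0}
    (hf : LipschitzWith C f) (e : Eu d) :
    ∫ x in ball 0 1, lineDeriv ℝ f x e = ∫ θ, inner ℝ θ e * f θ ∂(sphereMeasure d) := by
  -- The function `R ↦ ∫ ∂_e f · max (R - |x|) 0` is differentiated from the right at `R = 1` in two
  -- ways. Its polar form is the primitive of `m`, which gives `m 1` (`h4`); differentiating the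
  -- cutoff under the integral gives the integral of `∂_e f` over `B_1` (`h3`).
  set m : ℝ → ℝ := fun s => s ^ (d - 1) * ∫ θ, inner ℝ θ e * f (s • θ) ∂(sphereMeasure d) with hm
  have hmc : Continuous m := continuous_sphere_average hf.continuous e
  have h1 : HasDerivAt (fun R => ∫ s in (0 : ℝ)..R, m s) (m 1) 1 :=
    intervalIntegral.integral_hasDerivAt_right (hmc.intervalIntegrable _ _)
      hmc.stronglyMeasurable.stronglyMeasurableAtFilter hmc.continuousAt
  have h2 := h1.tendsto_slope_zero_right
  have hb : ∀ x, ‖lineDeriv ℝ f x e‖ ≤ C * ‖e‖ := fun x => norm_lineDeriv_le_of_lipschitz ℝ hf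
  have hmeas : AEStronglyMeasurable (fun x => lineDeriv ℝ f x e) volume :=
    aestronglyMeasurable_lineDeriv hf.continuous volume
  have hi : ∀ R : ℝ, Integrable fun x : Eu d => lineDeriv ℝ f x e * max (R - ‖x‖) 0 := fun R =>
    ((lipschitzWith_cutoff d R).continuous.integrable_of_hasCompactSupport
      (hasCompactSupport_cutoff d R)).bdd_mul hmeas (ae_of_all _ hb)
  have h3 : Tendsto (fun t : ℝ => ∫ x, lineDeriv ℝ f x e *
      (t⁻¹ * (max (1 + t - ‖x‖) 0 - max (1 - ‖x‖) 0))) (𝓝[>] 0)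
      (𝓝 (∫ x, lineDeriv ℝ f x e * (ball (0 : Eu d) 1).indicator (fun _ => 1) x)) := by
    refine tendsto_integral_filter_of_dominated_convergence
      ((ball (0 : Eu d) 2).indicator fun _ => C * ‖e‖) ?_ ?_ ?_ ?_
    · exact Eventually.of_forall fun t => hmeas.mul
        (Continuous.aestronglyMeasurable (by fun_prop))
    · have : ∀ᶠ t : ℝ in 𝓝[>] 0, t < 1 := nhdsWithin_le_nhds (gt_mem_nhds one_pos)
      filter_upwards [this, self_mem_nhdsWithin] with t ht ht0
      rw [mem_Ioi] at ht0
      filter_upwards with x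
      by_cases hx : x ∈ ball (0 : Eu d) 2
      · rw [indicator_of_mem hx, norm_mul]
        refine (mul_le_of_le_one_right (norm_nonneg _) ?_).trans (hb x)
        rw [norm_mul, norm_inv, Real.norm_of_nonneg ht0.le, inv_mul_le_one₀ ht0]
        refine (abs_max_sub_max_le_abs _ _ _).trans ?_
        rw [show 1 + t - ‖x‖ - (1 - ‖x‖) = t by ring, abs_of_pos ht0]
      · rw [indicator_of_notMem hx]
        simp only [mem_ball, dist_zero_right, not_lt] at hx
        rw [max_eq_right (by linarith), max_eq_right (by linarith)]
        simp
    · rw [integrable_indicator_iff measurableSet_ball]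
      exact integrableOn_const measure_ball_lt_top.ne
    · filter_upwards [ae_ne_zero_and_norm_ne d 1] with x hx
      exact tendsto_const_nhds.mul (tendsto_cutoff_quotient hx.2)
  have h4 : Tendsto (fun t : ℝ => ∫ x, lineDeriv ℝ f x e *
      (t⁻¹ * (max (1 + t - ‖x‖) 0 - max (1 - ‖x‖) 0))) (𝓝[>] 0) (𝓝 (m 1)) := by
    refine h2.congr' ?_
    filter_upwards [self_mem_nhdsWithin] with t ht
    rw [mem_Ioi] at ht
    simp only [hm, smul_eq_mul]
    rw [← integral_lineDeriv_mul_cutoff_eq_radial hf e (by linarith),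
      ← integral_lineDeriv_mul_cutoff_eq_radial hf e zero_le_one, ← integral_sub (hi _) (hi _),
      ← integral_const_mul]
    refine integral_congr_ae (ae_of_all _ fun x => ?_)
    ring
  have h5 := tendsto_nhds_unique h3 h4
  have h6 : ∀ x : Eu d, lineDeriv ℝ f x e * (ball (0 : Eu d) 1).indicator (fun _ => 1) x =
      (ball (0 : Eu d) 1).indicator (fun x => lineDeriv ℝ f x e) x := by
    intro x
    by_cases hx : x ∈ ball (0 : Eu d) 1 <;> simp [hx]
  simp only [h6, integral_indicator measurableSet_ball] at h5
  rw [h5, hm]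
  simp

/-- As `f` may be unbounded, the difference is split so that the factor `f` is evaluated where `φ ≠
0`; there it is bounded by compactness. Symmetry covers the case in which only the other point has
`φ ≠ 0`. -/
lemma LipschitzWith.mul_of_hasCompactSupport {d : ℕ} {f φ : Eu d → ℝ} {C D : ℝ≥0}
    (hf : LipschitzWith C f) (hφ : LipschitzWith D φ) (hc : HasCompactSupport φ) :
    ∃ K, LipschitzWith K fun x => f x * φ x := by
  obtain ⟨A, hA⟩ := IsCompact.exists_bound_of_continuousOn hc hf.continuous.continuousOn
  obtain ⟨B, hB⟩ := hc.exists_bound_of_continuous hφ.continuous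
  have key : ∀ x y, φ x ≠ 0 → |f x * φ x - f y * φ y| ≤ (|A| * D + B * C) * dist x y := by
    intro x y hx
    have h1 : f x * φ x - f y * φ y = f x * (φ x - φ y) + φ y * (f x - f y) := by ring
    have h2 : |f x| ≤ |A| := (hA x (subset_tsupport _ hx)).trans (le_abs_self A)
    have h3 := hφ.dist_le_mul x y
    have h4 := hf.dist_le_mul x y
    rw [Real.dist_eq] at h3 h4
    rw [h1]
    calc _ ≤ |f x * (φ x - φ y)| + |φ y * (f x - f y)| := abs_add_le _ _
      _ = |f x| * |φ x - φ y| + |φ y| * |f x - f y| := by rw [abs_mul, abs_mul]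
      _ ≤ |A| * (D * dist x y) + B * (C * dist x y) := by
        have hB0 : 0 ≤ B := (norm_nonneg _).trans (hB y)
        gcongr
        exact hB y
      _ = _ := by ring
  refine ⟨Real.toNNReal (|A| * D + B * C), LipschitzWith.of_dist_le_mul fun x y => ?_⟩
  have hBy : 0 ≤ B := (norm_nonneg _).trans (hB x)
  rw [Real.coe_toNNReal _ (by positivity), Real.dist_eq]
  by_cases hx : φ x = 0
  · by_cases hy : φ y = 0
    · simp only [hx, hy, mul_zero, sub_self, abs_zero]
      positivity
    · rw [abs_sub_comm, dist_comm]
      exact key y x hy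
  · exact key x y hx

/-- Test functions in Green's formula need not have compact support. Agreement on the ball of radius
`2` preserves both the values on the unit sphere and the derivatives in the unit ball. -/
lemma exists_contDiff_hasCompactSupport_eq_on_ball {d : ℕ} {φ : Eu d → ℝ} (hφ : ContDiff ℝ ∞ φ) :
    ∃ ψ : Eu d → ℝ, ContDiff ℝ ∞ ψ ∧ HasCompactSupport ψ ∧ ∀ x ∈ ball (0 : Eu d) 2, ψ x = φ x := by
  let b : ContDiffBump (0 : Eu d) := ⟨2, 3, by norm_num, by norm_num⟩
  refine ⟨fun x => b x * φ x, b.contDiff.mul hφ, b.hasCompactSupport.mul_right, fun x hx => ?_⟩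
  change b x * φ x = φ x
  rw [b.one_of_mem_closedBall (ball_subset_closedBall hx), one_mul]

/-- Green's formula for Lipschitz functions that are differentiable off the origin. -/
lemma GreenTriple.of_lipschitz {d : ℕ} [Nontrivial (Eu d)] {f : Eu d → ℝ} {C : ℝ≥0}
    (hf : LipschitzWith C f) {g : Eu d → Eu d} (hg : ∀ x ≠ 0, HasGradientAt f (g x) x)
    (hgL : MemLp g 2 (volume.restrict (ball 0 1))) : GreenTriple f g f := by
  refine ⟨memLp_two_ball_of_continuous hf.continuous 1, hgL,
    memLp_two_sphere_of_continuous hf.continuous, fun φ hφ e => ?_⟩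
  obtain ⟨ψ, hψ, hψc, hψe⟩ := exists_contDiff_hasCompactSupport_eq_on_ball hφ
  obtain ⟨D, hD⟩ := ContDiff.lipschitzWith_of_hasCompactSupport hψc hψ (by simp)
  obtain ⟨K, hK⟩ := LipschitzWith.mul_of_hasCompactSupport hf hD hψc
  -- Green's formula is the divergence theorem for the product `f ψ`, whose Lipschitz bound needs
  -- the compact support of `ψ`.
  have h1 := integral_lineDeriv_ball hK e
  have h2 : ∫ x, f x * φ x * inner ℝ x e ∂(sphereMeasure d) =
      ∫ x, inner ℝ x e * (f x * ψ x) ∂(sphereMeasure d) := by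
    refine integral_congr_ae ?_
    filter_upwards [ae_norm_sphereMeasure d] with x hx
    rw [hψe x (by simp [hx])]
    ring
  rw [h2, ← h1]
  refine integral_congr_ae ?_
  filter_upwards [ae_restrict_mem measurableSet_ball,
    ae_restrict_of_ae (ae_ne_zero_and_norm_ne d 1)] with x hx hx0
  have hx2 : x ∈ ball (0 : Eu d) 2 := ball_subset_ball one_le_two hx
  have hψφ : ψ =ᶠ[𝓝 x] φ := by
    filter_upwards [isOpen_ball.mem_nhds hx2] with y hy using hψe y hy
  have h3 : HasFDerivAt ψ (fderiv ℝ φ x) x :=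
    ((hφ.differentiable (by simp)) x).hasFDerivAt.congr_of_eventuallyEq hψφ
  have h4 := (hg x hx0.1).hasFDerivAt.mul h3
  have h5 := (h4.hasLineDerivAt e).lineDeriv
  rw [show (fun x => f x * ψ x) = f * ψ from rfl, h5, hψe x hx2]
  simp

lemma continuous_gradient {d : ℕ} {f : Eu d → ℝ} (hf : ContDiff ℝ ∞ f) :
    Continuous (gradient f) :=
  (InnerProductSpace.toDual ℝ (Eu d)).symm.continuous.comp (hf.continuous_fderiv (by simp))

lemma GreenTriple.of_contDiff {d : ℕ} [Nontrivial (Eu d)] {f : Eu d → ℝ} (hf : ContDiff ℝ ∞ f)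
    (hc : HasCompactSupport f) : GreenTriple f (gradient f) f := by
  obtain ⟨D, hD⟩ := ContDiff.lipschitzWith_of_hasCompactSupport hc hf (by simp)
  exact GreenTriple.of_lipschitz hD
    (fun x _ => ((hf.differentiable (by simp)) x).hasGradientAt)
    (memLp_two_ball_of_continuous (continuous_gradient hf) 1)

/-- The square of the trace in terms of the function in the ball. -/
lemma integral_sq_sphere_eq {d : ℕ} [Nontrivial (Eu d)] {f : Eu d → ℝ} (hf : ContDiff ℝ ∞ f)
    (hc : HasCompactSupport f) :
    ∫ x, f x ^ 2 ∂(sphereMeasure d) =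
      ∫ x in ball (0 : Eu d) 1, (d * f x ^ 2 + 2 * f x * inner ℝ (gradient f x) x) := by
  have hG := GreenTriple.of_contDiff hf hc
  have hi : ∀ i : Fin d, ContDiff ℝ ∞ fun x : Eu d => f x * x i := fun i =>
    hf.mul (by fun_prop)
  -- Green's formula with test function `f x_i` and direction `e_i`, summed over `i`, is the
  -- divergence theorem for the field `f² x`.
  have hs := Finset.sum_congr (rfl : (Finset.univ : Finset (Fin d)) = Finset.univ)
    fun i _ => hG.green _ (hi i) (EuclideanSpace.single i 1)
  have hgc := continuous_gradient hf
  have hd : ∀ i : Fin d, ∀ x : Eu d, fderiv ℝ (fun x : Eu d => f x * x i) x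
      (EuclideanSpace.single i 1) = f x + x i * inner ℝ (gradient f x) (EuclideanSpace.single i 1) := by
    intro i x
    have h1 : HasFDerivAt (fun x : Eu d => x i) (EuclideanSpace.proj i : Eu d →L[ℝ] ℝ) x :=
      (EuclideanSpace.proj i : Eu d →L[ℝ] ℝ).hasFDerivAt
    have h2 := ((hf.differentiable (by simp)) x).hasFDerivAt.mul h1
    rw [show (fun x : Eu d => f x * x i) = f * fun x : Eu d => x i from rfl, h2.fderiv,
      inner_gradient_left]
    simp
  rw [← integral_finsetSum, ← integral_finsetSum] at hs
  · convert hs.symm using 1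
    · refine integral_congr_ae ?_
      filter_upwards [ae_norm_sphereMeasure d] with x hx
      have h1 : ∑ i, x i ^ 2 = 1 := by
        rw [← EuclideanSpace.real_norm_sq_eq x, hx, one_pow]
      simp only [EuclideanSpace.inner_single_right, one_mul, conj_trivial]
      rw [← mul_one (f x ^ 2), ← h1, Finset.mul_sum]
      exact Finset.sum_congr rfl fun i _ => by ring
    · refine integral_congr_ae (ae_of_all _ fun x => ?_)
      simp only [hd]
      have h1 : inner ℝ (gradient f x) x = ∑ i, x i * gradient f x i := by
        rw [PiLp.inner_apply]
        exact Finset.sum_congr rfl fun i _ => by simp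
      simp only [h1, EuclideanSpace.inner_single_right, one_mul, conj_trivial]
      rw [Finset.mul_sum]
      have h2 : (d : ℝ) * f x ^ 2 = ∑ _i : Fin d, f x ^ 2 := by simp
      rw [h2, ← Finset.sum_add_distrib]
      exact Finset.sum_congr rfl fun i _ => by ring
  · intro i _
    refine (memLp_two_sphere_of_continuous (F := ℝ) ?_).integrable one_le_two
    have := hf.continuous
    fun_prop
  · intro i _
    have := isFiniteMeasure_restrict_ball d 1
    refine (memLp_two_ball_of_continuous (F := ℝ) ?_ 1).integrable one_le_two
    simp only [hd]
    have := hf.continuous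
    fun_prop

/-! ### Mollification -/

lemma eLpNorm_two_sq {X : Type*} [MeasurableSpace X] {μ : Measure X} {F : Type*}
    [NormedAddCommGroup F] (f : X → F) : eLpNorm f 2 μ ^ 2 = ∫⁻ x, ‖f x‖ₑ ^ 2 ∂μ := by
  rw [eLpNorm_eq_lintegral_rpow_enorm_toReal two_ne_zero ENNReal.ofNat_ne_top, ← ENNReal.rpow_two,
    ← ENNReal.rpow_mul]
  simp

/-- Continuity of translations in `L²`. -/
lemma tendsto_eLpNorm_translate_sub {d : ℕ} {F : Type*} [NormedAddCommGroup F] {f : Eu d → F}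
    (hf : MemLp f 2) :
    Tendsto (fun t : Eu d => eLpNorm ((fun x => f (x - t)) - f) 2 volume) (𝓝 0) (𝓝 0) := by
  have : Fact ((2 : ENNReal) ≠ ⊤) := ⟨by simp⟩
  have hm : ∀ t : Eu d, MemLp (fun x => f (-t +ᵥ x)) 2 (volume : Measure (Eu d)) := fun t =>
    hf.comp_measurePreserving (measurePreserving_vadd (-t) volume)
  have h1 : Continuous fun t : Eu d => (DomAddAct.mk (-t) : (Eu d)ᵈᵃᵃ) +ᵥ hf.toLp f :=
    (DomAddAct.continuous_mk.comp continuous_neg).vadd continuous_const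
  have h2 : Tendsto (fun t : Eu d => (hm t).toLp _) (𝓝 0) (𝓝 (hf.toLp f)) := by
    have h3 := h1.tendsto 0
    have h4 : (DomAddAct.mk (-(0 : Eu d)) : (Eu d)ᵈᵃᵃ) +ᵥ hf.toLp f = hf.toLp f := by
      simp
    rw [h4] at h3
    exact h3
  rw [Lp.tendsto_Lp_iff_tendsto_eLpNorm''] at h2
  refine h2.congr fun t => ?_
  congr 2
  funext x
  simp [sub_eq_neg_add]

lemma sq_lintegral_le_of_isProbabilityMeasure {X : Type*} [MeasurableSpace X] {μ : Measure X}
    [IsProbabilityMeasure μ] {F : Type*} [NormedAddCommGroup F] {f : X → F}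
    (hf : AEStronglyMeasurable f μ) :
    (∫⁻ x, ‖f x‖ₑ ∂μ) ^ 2 ≤ ∫⁻ x, ‖f x‖ₑ ^ 2 ∂μ := by
  rw [← eLpNorm_two_sq, ← eLpNorm_one_eq_lintegral_enorm]
  gcongr
  exact eLpNorm_le_eLpNorm_of_exponent_le one_le_two hf

lemma isProbabilityMeasure_bump {d : ℕ} (b : ContDiffBump (0 : Eu d)) :
    IsProbabilityMeasure (volume.withDensity fun t => ENNReal.ofReal (b.normed volume t)) := by
  constructor
  rw [withDensity_apply _ MeasurableSet.univ, Measure.restrict_univ,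
    ← ofReal_integral_eq_lintegral_ofReal b.integrable_normed
      (ae_of_all _ b.nonneg_normed), b.integral_normed, ENNReal.ofReal_one]

/-- The kernel has mass one, so the difference is the average of `f (x - t) - f x` over a
probability measure, and Jensen's inequality brings the square inside. -/
lemma enorm_convolution_sub_sq_le {d : ℕ} {F : Type*} [NormedAddCommGroup F] [NormedSpace ℝ F]
    [CompleteSpace F] {f : Eu d → F} (hf : StronglyMeasurable f) (hL : LocallyIntegrable f)
    (b : ContDiffBump (0 : Eu d)) (x : Eu d) :
    ‖convolution (b.normed volume) f (ContinuousLinearMap.lsmul ℝ ℝ) volume x - f x‖ₑ ^ 2 ≤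
      ∫⁻ t, ‖f (x - t) - f x‖ₑ ^ 2
        ∂(volume.withDensity fun t => ENNReal.ofReal (b.normed volume t)) := by
  have := isProbabilityMeasure_bump b
  have hmeas : StronglyMeasurable fun t => f (x - t) - f x :=
    (hf.comp_measurable (measurable_const.sub measurable_id)).sub stronglyMeasurable_const
  refine le_trans ?_ (sq_lintegral_le_of_isProbabilityMeasure hmeas.aestronglyMeasurable)
  gcongr
  have h1 : Integrable (fun t => b.normed volume t • f (x - t)) :=
    b.hasCompactSupport_normed.convolutionExists_left (ContinuousLinearMap.lsmul ℝ ℝ)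
      b.continuous_normed hL x
  have h2 : convolution (b.normed volume) f (ContinuousLinearMap.lsmul ℝ ℝ) volume x - f x =
      ∫ t, b.normed volume t • (f (x - t) - f x) := by
    simp only [smul_sub]
    rw [convolution_lsmul, integral_sub h1 (b.integrable_normed.smul_const _),
      b.integral_normed_smul]
  rw [h2, lintegral_withDensity_eq_lintegral_mul _
    (b.continuous_normed.measurable.ennreal_ofReal) hmeas.enorm]
  refine (enorm_integral_le_lintegral_enorm _).trans (le_of_eq ?_)
  refine lintegral_congr fun t => ?_
  rw [enorm_smul, Real.enorm_eq_ofReal (b.nonneg_normed t)]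
  rfl

/-- By Tonelli the squared error is at most the average over `t` of the squared `L²` distance
between `f` and its translate, and only `t` in the support of the kernel count. Strong measurability
makes the integrand jointly measurable. -/
lemma eLpNorm_convolution_sub_le_of_stronglyMeasurable {d : ℕ} {F : Type*} [NormedAddCommGroup F]
    [NormedSpace ℝ F] [CompleteSpace F] {f : Eu d → F} (hf : StronglyMeasurable f) (h2 : MemLp f 2)
    (b : ContDiffBump (0 : Eu d)) {ε : ENNReal}
    (hb : ∀ t ∈ ball (0 : Eu d) b.rOut, eLpNorm ((fun x => f (x - t)) - f) 2 volume ≤ ε) :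
    eLpNorm (convolution (b.normed volume) f (ContinuousLinearMap.lsmul ℝ ℝ) volume - f) 2 volume
      ≤ ε := by
  have := isProbabilityMeasure_bump b
  set μ := (volume : Measure (Eu d)).withDensity fun t => ENNReal.ofReal (b.normed volume t) with hμ
  rw [← ENNReal.pow_le_pow_left_iff two_ne_zero, eLpNorm_two_sq]
  have hL : LocallyIntegrable f := h2.locallyIntegrable one_le_two
  calc _ ≤ ∫⁻ x, ∫⁻ t, ‖f (x - t) - f x‖ₑ ^ 2 ∂μ :=
        lintegral_mono fun x => enorm_convolution_sub_sq_le hf hL b x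
    _ = ∫⁻ t, ∫⁻ x, ‖f (x - t) - f x‖ₑ ^ 2 ∂volume ∂μ := by
        have hmeas : Measurable fun p : Eu d × Eu d => ‖f (p.1 - p.2) - f p.1‖ₑ ^ 2 := (((hf.comp_measurable (measurable_fst.sub measurable_snd)).sub
          (hf.comp_measurable measurable_fst)).enorm).pow_const 2
        exact lintegral_lintegral_swap hmeas.aemeasurable
    _ ≤ ∫⁻ _t, ε ^ 2 ∂μ := by
        refine lintegral_mono_ae ?_
        rw [hμ, ae_withDensity_iff b.continuous_normed.measurable.ennreal_ofReal]
        refine ae_of_all _ fun t ht => ?_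
        have ht' : t ∈ Function.support (b.normed volume) := fun h0 => ht (by simp [h0])
        rw [b.support_normed_eq] at ht'
        have := hb t ht'
        rw [← ENNReal.pow_le_pow_left_iff two_ne_zero, eLpNorm_two_sq] at this
        exact this
    _ = ε ^ 2 := by simp

/-- Mollifications converge in `L²`. -/
lemma eLpNorm_convolution_sub_le {d : ℕ} {F : Type*} [NormedAddCommGroup F]
    [NormedSpace ℝ F] [CompleteSpace F] {f : Eu d → F} (hf : MemLp f 2) {ε : ENNReal} (hε : 0 < ε) :
    ∃ δ > 0, ∀ b : ContDiffBump (0 : Eu d), b.rOut < δ →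
      eLpNorm (convolution (b.normed volume) f (ContinuousLinearMap.lsmul ℝ ℝ) volume - f) 2 volume
        ≤ ε := by
  set f' := hf.1.mk f with hf'
  have hff : f =ᵐ[volume] f' := hf.1.ae_eq_mk
  have hm : MemLp f' 2 := hf.ae_eq hff
  have h1 := tendsto_eLpNorm_translate_sub hm
  have h2 : ∀ᶠ t : Eu d in 𝓝 0, eLpNorm ((fun x => f' (x - t)) - f') 2 volume ≤ ε :=
    (h1.eventually (ge_mem_nhds hε))
  obtain ⟨δ, hδ, hδ'⟩ := Metric.eventually_nhds_iff_ball.1 h2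
  refine ⟨δ, hδ, fun b hb => ?_⟩
  rw [convolution_congr (ContinuousLinearMap.lsmul ℝ ℝ) EventuallyEq.rfl hff]
  rw [eLpNorm_congr_ae (EventuallyEq.rfl.sub hff)]
  exact eLpNorm_convolution_sub_le_of_stronglyMeasurable hf.1.stronglyMeasurable_mk hm b
    fun t ht => hδ' t (ball_subset_ball hb.le ht)

/-- The derivative falls on the kernel, and `y ↦ b (x - y)` is an admissible test function because
`‖x‖ + b.rOut < R` keeps its support inside `B_R`. Differentiation in `y` instead of `x` changes the
sign, which cancels the minus sign in the weak gradient identity. -/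
lemma gradient_convolution_eq {d : ℕ} {R : ℝ} {v : Eu d → ℝ} {g : Eu d → Eu d}
    (hv : IntegrableOn v (ball 0 R)) (hg : IntegrableOn g (ball 0 R))
    (h : HasWeakGrad (ball 0 R) v g) (b : ContDiffBump (0 : Eu d)) {x : Eu d}
    (hx : ‖x‖ + b.rOut < R) :
    gradient (convolution (b.normed volume) ((ball 0 R).indicator v)
      (ContinuousLinearMap.lsmul ℝ ℝ) volume) x =
      convolution (b.normed volume) ((ball 0 R).indicator g)
        (ContinuousLinearMap.lsmul ℝ ℝ) volume x := by
  have hvi : Integrable ((ball 0 R).indicator v) := (integrable_indicator_iff measurableSet_ball).2 hv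
  have hgi : Integrable ((ball 0 R).indicator g) := (integrable_indicator_iff measurableSet_ball).2 hg
  have hK : ContDiff ℝ ∞ (b.normed volume) := b.contDiff_normed
  have hKc : HasCompactSupport (b.normed volume) := b.hasCompactSupport_normed
  have hflip : convolution (b.normed volume) ((ball 0 R).indicator v)
      (ContinuousLinearMap.lsmul ℝ ℝ) volume =
      convolution ((ball 0 R).indicator v) (b.normed volume) (ContinuousLinearMap.mul ℝ ℝ)
        volume := by
    funext y
    rw [convolution_lsmul_swap, convolution_mul]
    simp only [smul_eq_mul, mul_comm]
  have hd := hKc.hasFDerivAt_convolution_right (ContinuousLinearMap.mul ℝ ℝ)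
    hvi.locallyIntegrable (hK.of_le (by simp)) x
  refine ext_inner_right ℝ fun e => ?_
  rw [inner_gradient_left, hflip, hd.fderiv,
    convolution_precompR_apply _ hvi.locallyIntegrable (hKc.fderiv ℝ)
      (hK.continuous_fderiv (by simp)), convolution_mul, convolution_lsmul_swap]
  set φ : Eu d → ℝ := fun y => b.normed volume (x - y) with hφ
  have hφs : ContDiff ℝ ∞ φ := hK.comp (contDiff_const.sub contDiff_id)
  have hsub : Function.support φ ⊆ closedBall x b.rOut := fun y hy => by
    have : x - y ∈ Function.support (b.normed volume) := hy
    rw [b.support_normed_eq, mem_ball, dist_zero_right] at this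
    rw [mem_closedBall, dist_comm, dist_eq_norm]
    exact this.le
  have hφc : HasCompactSupport φ :=
    HasCompactSupport.of_support_subset_isCompact (isCompact_closedBall x b.rOut) hsub
  have hts : tsupport φ ⊆ ball 0 R := by
    refine (closure_minimal hsub isClosed_closedBall).trans fun y hy => ?_
    rw [mem_closedBall, dist_eq_norm] at hy
    have := norm_add_le (y - x) x
    rw [sub_add_cancel] at this
    rw [mem_ball, dist_zero_right]
    linarith
  have hfd : ∀ y, fderiv ℝ φ y e = -fderiv ℝ (b.normed volume) (x - y) e := fun y => by
    have h1 : HasFDerivAt (fun y => x - y) (-ContinuousLinearMap.id ℝ (Eu d)) y :=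
      (hasFDerivAt_id y).const_sub x
    have h2 := ((hK.differentiable (by simp)) (x - y)).hasFDerivAt.comp y h1
    have h3 : fderiv ℝ φ y = _ := h2.fderiv
    rw [h3]
    simp
  have key := h.eq φ hφs hφc hts e
  have e1 : ∫ t, (ball 0 R).indicator v t * fderiv ℝ (b.normed volume) (x - t) e =
      -∫ t in ball 0 R, v t * fderiv ℝ φ t e := by
    rw [← integral_neg, ← integral_indicator measurableSet_ball]
    refine integral_congr_ae (ae_of_all _ fun t => ?_)
    by_cases ht : t ∈ ball (0 : Eu d) R
    · simp [hfd, ht, indicator]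
    · simp only [indicator_of_notMem ht, zero_mul]
  rw [e1, key, neg_neg]
  have hint : Integrable fun t => φ t • (ball 0 R).indicator g t :=
    hgi.bdd_smul (hφc.exists_bound_of_continuous hφs.continuous).choose
      hφs.continuous.aestronglyMeasurable
      (ae_of_all _ (hφc.exists_bound_of_continuous hφs.continuous).choose_spec)
  rw [real_inner_comm, ← integral_inner hint, ← integral_indicator measurableSet_ball]
  refine integral_congr_ae (ae_of_all _ fun t => ?_)
  by_cases ht : t ∈ ball (0 : Eu d) R
  · simp [ht, indicator, inner_smul_right, real_inner_comm]
  · simp [indicator_of_notMem ht]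

/-- Local approximation of Sobolev functions by smooth functions. -/
lemma exists_smooth_approx {d : ℕ} {R R' : ℝ} (hRR : R' < R) {v : Eu d → ℝ}
    {g : Eu d → Eu d} (hv : MemLp v 2 (volume.restrict (ball 0 R)))
    (hg : MemLp g 2 (volume.restrict (ball 0 R))) (h : HasWeakGrad (ball 0 R) v g)
    {ε : ENNReal} (hε : 0 < ε) :
    ∃ φ : Eu d → ℝ, ContDiff ℝ ∞ φ ∧ HasCompactSupport φ ∧
      eLpNorm (φ - v) 2 (volume.restrict (ball 0 R')) ≤ ε ∧
      eLpNorm (gradient φ - g) 2 (volume.restrict (ball 0 R')) ≤ ε := by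
  have := isFiniteMeasure_restrict_ball d R
  have hvi : MemLp ((ball 0 R).indicator v) 2 := (memLp_indicator_iff_restrict measurableSet_ball).2 hv
  have hgi : MemLp ((ball 0 R).indicator g) 2 := (memLp_indicator_iff_restrict measurableSet_ball).2 hg
  obtain ⟨δ₁, hδ₁, h₁⟩ := eLpNorm_convolution_sub_le hvi hε
  obtain ⟨δ₂, hδ₂, h₂⟩ := eLpNorm_convolution_sub_le hgi hε
  -- Below both `L²` thresholds, and small enough that averages centred in `B_R'` only involve
  -- points of `B_R`, where the weak gradient identity holds.
  set ρ := min (min δ₁ δ₂) (R - R') / 2 with hρ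
  have hm : 0 < min (min δ₁ δ₂) (R - R') := lt_min (lt_min hδ₁ hδ₂) (by linarith)
  have hρ0 : 0 < ρ := by positivity
  have hρm : ρ < min (min δ₁ δ₂) (R - R') := half_lt_self hm
  let b : ContDiffBump (0 : Eu d) := ⟨ρ / 2, ρ, by positivity, by linarith⟩
  have hvc : HasCompactSupport ((ball (0 : Eu d) R).indicator v) :=
    HasCompactSupport.of_support_subset_isCompact (isCompact_closedBall 0 R)
      (support_indicator_subset.trans ball_subset_closedBall)
  refine ⟨convolution (b.normed volume) ((ball 0 R).indicator v)
      (ContinuousLinearMap.lsmul ℝ ℝ) volume, ?_, ?_, ?_, ?_⟩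
  · exact b.hasCompactSupport_normed.contDiff_convolution_left _ b.contDiff_normed
      (hvi.locallyIntegrable one_le_two)
  · exact HasCompactSupport.convolution _ b.hasCompactSupport_normed hvc
  · refine le_trans (le_of_eq ?_) ((eLpNorm_mono_measure _
      (Measure.restrict_le_self (s := ball 0 R'))).trans
      (h₁ b (hρm.trans_le ((min_le_left _ _).trans (min_le_left _ _)))))
    refine eLpNorm_congr_ae ?_
    filter_upwards [ae_restrict_mem measurableSet_ball] with x hx
    rw [Pi.sub_apply, Pi.sub_apply, indicator_of_mem (ball_subset_ball hRR.le hx)]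
  · refine le_trans (le_of_eq ?_) ((eLpNorm_mono_measure _
      (Measure.restrict_le_self (s := ball 0 R'))).trans
      (h₂ b (hρm.trans_le ((min_le_left _ _).trans (min_le_right _ _)))))
    refine eLpNorm_congr_ae ?_
    filter_upwards [ae_restrict_mem measurableSet_ball] with x hx
    have hx' : ‖x‖ + b.rOut < R := by
      have h3 : ρ < R - R' := hρm.trans_le (min_le_right _ _)
      have h4 : ‖x‖ < R' := by simpa using hx
      change ‖x‖ + ρ < R
      linarith
    rw [Pi.sub_apply, Pi.sub_apply, gradient_convolution_eq (hv.integrable one_le_two)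
      (hg.integrable one_le_two) h b hx', indicator_of_mem (ball_subset_ball hRR.le hx)]

/-! ### Scaling -/

lemma map_smul_restrict_ball {d : ℕ} {r : ℝ} (hr : 0 < r) :
    (volume.restrict (ball (0 : Eu d) 1)).map (fun x => r • x) =
      ENNReal.ofReal (r ^ d)⁻¹ • volume.restrict (ball 0 r) := by
  have h1 := Measure.map_addHaar_smul (volume : Measure (Eu d)) hr.ne'
  rw [finrank_euclideanSpace_fin, abs_of_pos (by positivity)] at h1
  have h2 := Measure.restrict_map (μ := (volume : Measure (Eu d))) (f := fun x : Eu d => r • x)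
    (by fun_prop) (measurableSet_ball (x := (0 : Eu d)) (ε := r))
  have h3 : (fun x : Eu d => r • x) ⁻¹' ball 0 r = ball 0 1 := by
    ext x
    simp [norm_smul, abs_of_pos hr, hr]
  rw [h3] at h2
  rw [← h2]
  erw [h1]
  rw [Measure.restrict_smul]

lemma measurableEmbedding_smul {d : ℕ} {r : ℝ} (hr : 0 < r) :
    MeasurableEmbedding fun x : Eu d => r • x :=
  (Homeomorph.smulOfNeZero r hr.ne').measurableEmbedding

lemma integral_ball_scale {d : ℕ} {r : ℝ} (hr : 0 < r) (f : Eu d → ℝ) :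
    ∫ x in ball (0 : Eu d) 1, f (r • x) = (r ^ d)⁻¹ * ∫ x in ball (0 : Eu d) r, f x := by
  rw [← (measurableEmbedding_smul hr).integral_map f, map_smul_restrict_ball hr,
    integral_smul_measure, ENNReal.toReal_ofReal (by positivity), smul_eq_mul]

lemma eLpNorm_ball_scale {d : ℕ} {F : Type*} [NormedAddCommGroup F] {r : ℝ} (hr : 0 < r)
    (f : Eu d → F) :
    eLpNorm (fun x => f (r • x)) 2 (volume.restrict (ball (0 : Eu d) 1)) =
      ENNReal.ofReal (r ^ d)⁻¹ ^ (1 / (2 : ENNReal)).toReal *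
        eLpNorm f 2 (volume.restrict (ball (0 : Eu d) r)) := by
  have h := (measurableEmbedding_smul hr).eLpNorm_map_measure (g := f) (p := 2)
    (μ := volume.restrict (ball (0 : Eu d) 1))
  rw [map_smul_restrict_ball hr, eLpNorm_smul_measure_of_ne_top (by simp)] at h
  exact h.symm

lemma memLp_ball_scale {d : ℕ} {F : Type*} [NormedAddCommGroup F] {r : ℝ} (hr : 0 < r)
    {f : Eu d → F} (hf : MemLp f 2 (volume.restrict (ball 0 r))) :
    MemLp (fun x => f (r • x)) 2 (volume.restrict (ball (0 : Eu d) 1)) := by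
  refine (measurableEmbedding_smul hr).memLp_map_measure_iff.1 ?_
  rw [map_smul_restrict_ball hr]
  exact hf.smul_measure (by simp)

lemma tendsto_eLpNorm_ball_scale {d : ℕ} {F : Type*} [NormedAddCommGroup F] {r : ℝ} (hr : 0 < r)
    {f : ℕ → Eu d → F} {f₀ : Eu d → F}
    (h : Tendsto (fun n => eLpNorm (f n - f₀) 2 (volume.restrict (ball 0 r))) atTop (𝓝 0)) :
    Tendsto (fun n => eLpNorm ((fun x => f n (r • x)) - fun x => f₀ (r • x)) 2
      (volume.restrict (ball (0 : Eu d) 1))) atTop (𝓝 0) := by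
  have h1 := ENNReal.Tendsto.const_mul
    (a := ENNReal.ofReal (r ^ d)⁻¹ ^ (1 / (2 : ENNReal)).toReal) h (Or.inr (by simp))
  rw [mul_zero] at h1
  refine h1.congr fun n => ?_
  rw [← eLpNorm_ball_scale hr]
  rfl

/-! ### Existence of traces -/

lemma norm_toLp_sq {X : Type*} [MeasurableSpace X] {μ : Measure X} {F : Type*}
    [NormedAddCommGroup F] [InnerProductSpace ℝ F] {f : X → F} (hf : MemLp f 2 μ) :
    ‖hf.toLp f‖ ^ 2 = ∫ x, ‖f x‖ ^ 2 ∂μ := by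
  rw [← real_inner_self_eq_norm_sq, L2.inner_def]
  refine integral_congr_ae ?_
  filter_upwards [hf.coeFn_toLp] with x hx
  rw [hx, real_inner_self_eq_norm_sq]

lemma integrable_norm_sq_of_L2 {X : Type*} [MeasurableSpace X] {μ : Measure X} {F : Type*}
    [NormedAddCommGroup F] [InnerProductSpace ℝ F] {f : X → F} (hf : MemLp f 2 μ) :
    Integrable (fun x => ‖f x‖ ^ 2) μ := by
  simpa only [real_inner_self_eq_norm_sq] using integrable_inner_of_L2 hf hf

lemma memLp_smul_id_ball {d : ℕ} {v : Eu d → ℝ} (hv : MemLp v 2 (volume.restrict (ball 0 1))) :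
    MemLp (fun x => v x • x) 2 (volume.restrict (ball 0 1)) := by
  refine hv.mono (hv.1.smul (Continuous.aestronglyMeasurable continuous_id)) ?_
  filter_upwards [ae_restrict_mem measurableSet_ball] with x hx
  rw [norm_smul]
  exact mul_le_of_le_one_right (norm_nonneg _) (by simpa using (mem_ball_zero_iff.1 hx).le)

lemma integral_div_split {d : ℕ} {v : Eu d → ℝ} {g : Eu d → Eu d}
    (hv : MemLp v 2 (volume.restrict (ball 0 1))) (hg : MemLp g 2 (volume.restrict (ball 0 1))) :
    ∫ x in ball (0 : Eu d) 1, (d * v x ^ 2 + 2 * v x * inner ℝ (g x) x) =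
      d * (∫ x in ball (0 : Eu d) 1, inner ℝ (v x) (v x)) +
        2 * ∫ x in ball (0 : Eu d) 1, inner ℝ (g x) (v x • x) := by
  rw [← integral_const_mul, ← integral_const_mul, ← integral_add
    ((integrable_inner_of_L2 hv hv).const_mul _)
    ((integrable_inner_of_L2 hg (memLp_smul_id_ball hv)).const_mul _)]
  refine integral_congr_ae (ae_of_all _ fun x => ?_)
  simp only [inner_smul_right, real_inner_self_eq_norm_sq, Real.norm_eq_abs, sq_abs]
  ring

/-- The trace inequality for smooth functions. -/
lemma norm_toLp_sphere_le {d : ℕ} [Nontrivial (Eu d)] {f : Eu d → ℝ} (hf : ContDiff ℝ ∞ f)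
    (hc : HasCompactSupport f) (h1 : MemLp f 2 (sphereMeasure d))
    (h2 : MemLp f 2 (volume.restrict (ball 0 1)))
    (h3 : MemLp (gradient f) 2 (volume.restrict (ball 0 1))) :
    ‖h1.toLp f‖ ≤ (d + 1) * (‖h2.toLp f‖ + ‖h3.toLp (gradient f)‖) := by
  have e1 := norm_toLp_sq h1
  have e2 := norm_toLp_sq h2
  have e3 := norm_toLp_sq h3
  -- Since `|x| ≤ 1`, Young's inequality bounds `d f² + 2 f ∇f·x` by `(d + 1) f² + |∇f|²`.
  have key : ‖h1.toLp f‖ ^ 2 ≤ (d + 1) * ‖h2.toLp f‖ ^ 2 + ‖h3.toLp (gradient f)‖ ^ 2 := by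
    rw [e1, e2, e3]
    simp only [Real.norm_eq_abs, sq_abs]
    rw [integral_sq_sphere_eq hf hc, ← integral_const_mul]
    have i2 : Integrable (fun x => f x ^ 2) (volume.restrict (ball 0 1)) := by
      simpa using integrable_norm_sq_of_L2 h2
    have i3 := integrable_norm_sq_of_L2 h3
    rw [← integral_add (i2.const_mul _) i3]
    refine integral_mono_ae ?_ ((i2.const_mul _).add i3) ?_
    · have := ((integrable_inner_of_L2 h3 (memLp_smul_id_ball h2)).const_mul 2).add
        (i2.const_mul (d : ℝ))
      refine this.congr (ae_of_all _ fun x => ?_)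
      simp only [inner_smul_right, Pi.add_apply]
      ring
    · filter_upwards [ae_restrict_mem measurableSet_ball] with x hx
      have hx1 : ‖x‖ ≤ 1 := (mem_ball_zero_iff.1 hx).le
      have hin : |inner ℝ (gradient f x) x| ≤ ‖gradient f x‖ :=
        (abs_real_inner_le_norm _ _).trans (mul_le_of_le_one_right (norm_nonneg _) hx1)
      have h5 : f x * inner ℝ (gradient f x) x ≤ |f x| * ‖gradient f x‖ :=
        (le_abs_self _).trans (by rw [abs_mul]; gcongr)
      nlinarith [sq_nonneg (|f x| - ‖gradient f x‖), sq_abs (f x)]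
  refine abs_le_of_sq_le_sq' (key.trans ?_) (by positivity) |>.2
  have hd : (0 : ℝ) ≤ d := Nat.cast_nonneg d
  have := norm_nonneg (h2.toLp f)
  have := norm_nonneg (h3.toLp (gradient f))
  rw [mul_pow]
  nlinarith [mul_nonneg (norm_nonneg (h2.toLp f)) (norm_nonneg (h3.toLp (gradient f))),
    mul_nonneg hd (sq_nonneg (‖h2.toLp f‖ + ‖h3.toLp (gradient f)‖)),
    mul_nonneg hd (mul_nonneg (norm_nonneg (h2.toLp f)) (norm_nonneg (h3.toLp (gradient f)))),
    mul_nonneg hd (sq_nonneg ‖h2.toLp f‖), mul_nonneg hd (sq_nonneg ‖h3.toLp (gradient f)‖),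
    mul_nonneg (mul_nonneg hd hd) (sq_nonneg (‖h2.toLp f‖ + ‖h3.toLp (gradient f)‖))]

lemma gradient_sub_of_contDiff {d : ℕ} {f h : Eu d → ℝ} (hf : ContDiff ℝ ∞ f)
    (hh : ContDiff ℝ ∞ h) : gradient (f - h) = gradient f - gradient h := by
  funext x
  have h1 := ((hf.differentiable (by simp)) x).hasGradientAt.hasFDerivAt
  have h2 := ((hh.differentiable (by simp)) x).hasGradientAt.hasFDerivAt
  have h3 := h1.sub h2
  rw [← map_sub] at h3
  exact (hasGradientAt_iff_hasFDerivAt.2 h3).gradient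

/-- A limit of smooth functions in `H¹` of the unit ball has a trace, which is the limit of the
traces. -/
lemma exists_greenTriple {d : ℕ} [Nontrivial (Eu d)] {w : ℕ → Eu d → ℝ}
    (hw : ∀ n, ContDiff ℝ ∞ (w n)) (hc : ∀ n, HasCompactSupport (w n)) {v : Eu d → ℝ}
    {g : Eu d → Eu d} (hv : MemLp v 2 (volume.restrict (ball 0 1)))
    (hg : MemLp g 2 (volume.restrict (ball 0 1)))
    (tv : Tendsto (fun n => eLpNorm (w n - v) 2 (volume.restrict (ball 0 1))) atTop (𝓝 0))
    (tg : Tendsto (fun n => eLpNorm (gradient (w n) - g) 2 (volume.restrict (ball 0 1)))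
      atTop (𝓝 0)) :
    ∃ T, GreenTriple v g T ∧
      ∫ x, T x ^ 2 ∂(sphereMeasure d) =
        ∫ x in ball (0 : Eu d) 1, (d * v x ^ 2 + 2 * v x * inner ℝ (g x) x) ∧
      Tendsto (fun n => eLpNorm (w n - (T : Eu d → ℝ)) 2 (sphereMeasure d)) atTop (𝓝 0) := by
  have hG : ∀ n, GreenTriple (w n) (gradient (w n)) (w n) := fun n =>
    GreenTriple.of_contDiff (hw n) (hc n)
  have c1 := ((Lp.tendsto_Lp_iff_tendsto_eLpNorm'' w (fun n => (hG n).memLp) v hv).2 tv).cauchySeq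
  have c2 := ((Lp.tendsto_Lp_iff_tendsto_eLpNorm'' (fun n => gradient (w n))
    (fun n => (hG n).memLp_grad) g hg).2 tg).cauchySeq
  -- The trace inequality, applied to the differences `w p.1 - w p.2`, carries the Cauchy property
  -- from the ball to the sphere.
  have c3 : CauchySeq fun n => (hG n).memLp_trace.toLp (w n) := by
    rw [cauchySeq_iff_tendsto_dist_atTop_0] at c1 c2 ⊢
    have c4 := (c1.add c2).const_mul ((d : ℝ) + 1)
    rw [add_zero, mul_zero] at c4
    refine squeeze_zero (fun _ => dist_nonneg) (fun p => ?_) c4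
    have hs : ContDiff ℝ ∞ (w p.1 - w p.2) := (hw p.1).sub (hw p.2)
    have hsc : HasCompactSupport (w p.1 - w p.2) := (hc p.1).sub (hc p.2)
    have h3 : MemLp (gradient (w p.1 - w p.2)) 2 (volume.restrict (ball 0 1)) := by
      rw [gradient_sub_of_contDiff (hw _) (hw _)]
      exact (hG p.1).memLp_grad.sub (hG p.2).memLp_grad
    have := norm_toLp_sphere_le hs hsc ((hG p.1).memLp_trace.sub (hG p.2).memLp_trace)
      ((hG p.1).memLp.sub (hG p.2).memLp) h3
    simp only [gradient_sub_of_contDiff (hw p.1) (hw p.2)] at this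
    rw [MemLp.toLp_sub, MemLp.toLp_sub, MemLp.toLp_sub] at this
    simpa only [dist_eq_norm] using this
  obtain ⟨T, hT⟩ := cauchySeq_tendsto_of_complete c3
  have hTm : MemLp (T : Eu d → ℝ) 2 (sphereMeasure d) := Lp.memLp T
  have tT : Tendsto (fun n => eLpNorm (w n - (T : Eu d → ℝ)) 2 (sphereMeasure d)) atTop (𝓝 0) := by
    rw [← Lp.tendsto_Lp_iff_tendsto_eLpNorm'' w (fun n => (hG n).memLp_trace) T hTm,
      Lp.toLp_coeFn]
    exact hT
  refine ⟨T, GreenTriple.of_tendsto hG hv hg hTm tv tg tT, ?_, tT⟩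
  have l1 := tendsto_integral_inner_of_L2 (fun n => (hG n).memLp_trace) hTm
    (fun n => (hG n).memLp_trace) hTm tT tT
  have l2 := tendsto_integral_inner_of_L2 (fun n => (hG n).memLp) hv
    (fun n => (hG n).memLp) hv tv tv
  have l3 := tendsto_integral_inner_of_L2 (fun n => (hG n).memLp_grad) hg
    (fun n => memLp_smul_id_ball (hG n).memLp) (memLp_smul_id_ball hv) tg
    (tendsto_of_tendsto_of_tendsto_of_le_of_le tendsto_const_nhds tv (fun _ => zero_le)
      fun n => eLpNorm_mono_ae (by
        filter_upwards [ae_restrict_mem measurableSet_ball] with x hx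
        rw [Pi.sub_apply, Pi.sub_apply, ← sub_smul, norm_smul]
        exact mul_le_of_le_one_right (norm_nonneg _) (mem_ball_zero_iff.1 hx).le))
  have l4 := (l2.const_mul (d : ℝ)).add (l3.const_mul 2)
  simp only [← integral_div_split (hG _).memLp (hG _).memLp_grad] at l4
  rw [← integral_div_split hv hg] at l4
  simp only [real_inner_self_eq_norm_sq, Real.norm_eq_abs, sq_abs,
    integral_sq_sphere_eq (hw _) (hc _)] at l1
  exact tendsto_nhds_unique l1 l4

/-! ### Restrictions to spheres -/

lemma memLp_sphere_of_ball {d : ℕ} [Nontrivial (Eu d)] {R : ℝ} {F : Type*}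
    [NormedAddCommGroup F] [InnerProductSpace ℝ F] {f : Eu d → F}
    (h : MemLp f 2 (volume.restrict (ball 0 R))) :
    ∀ᵐ s : ℝ, s ∈ Ioo 0 R → MemLp (fun θ => f (s • θ)) 2 (sphereMeasure d) := by
  filter_upwards [aestronglyMeasurable_sphere_of_ball h.1,
    integrable_sphere_of_integrableOn_ball (f := fun x => ‖f x‖ ^ 2)
      (integrable_norm_sq_of_L2 h)] with s h1 h2 hs
  exact (memLp_two_iff_integrable_sq_norm (h1 hs)).2 (h2 hs)

/-- By Fubini the sum of the squared norms on spheres has finite integral in the radius. It is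
therefore finite for almost every radius, and its terms tend to zero along the whole sequence. -/
lemma tendsto_eLpNorm_sphere_of_tsum {d : ℕ} [Nontrivial (Eu d)] {R : ℝ} {F : Type*}
    [NormedAddCommGroup F] {f : ℕ → Eu d → F}
    (hf : ∀ n, AEStronglyMeasurable (f n) (volume.restrict (ball 0 R)))
    (hs : ∑' n, eLpNorm (f n) 2 (volume.restrict (ball 0 R)) ^ 2 ≠ ⊤) :
    ∀ᵐ s : ℝ, s ∈ Ioo 0 R →
      Tendsto (fun n => eLpNorm (fun θ => f n (s • θ)) 2 (sphereMeasure d)) atTop (𝓝 0) := by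
  have hp := measurePreserving_polar d R
  have hm : ∀ n, AEMeasurable (fun p : ℝ × Eu d => ‖f n (p.1 • p.2)‖ₑ ^ 2)
      ((radialMeasure d R).prod (sphereMeasure d)) := fun n =>
    (((hf n).comp_measurePreserving hp).enorm).pow_const 2
  have hn : ∀ n, eLpNorm (f n) 2 (volume.restrict (ball 0 R)) ^ 2 =
      ∫⁻ s, eLpNorm (fun θ => f n (s • θ)) 2 (sphereMeasure d) ^ 2 ∂(radialMeasure d R) := by
    intro n
    simp only [eLpNorm_two_sq]
    rw [← lintegral_prod _ (hm n)]
    rw [← hp.map_eq, lintegral_map' _ hp.measurable.aemeasurable]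
    rw [hp.map_eq]
    exact ((hf n).enorm).pow_const 2
  simp only [hn] at hs
  rw [← lintegral_tsum fun n => by
    simp only [eLpNorm_two_sq]; exact (hm n).lintegral_prod_right'] at hs
  have hfin := ae_lt_top' (AEMeasurable.tsum fun n => by
    simp only [eLpNorm_two_sq]; exact (hm n).lintegral_prod_right') hs
  refine (ae_radialMeasure_iff (d := d)).1 ?_
  filter_upwards [hfin] with s hs
  have h1 := ENNReal.tendsto_atTop_zero_of_tsum_ne_top hs.ne
  have h2 := (ENNReal.continuous_rpow_const (y := (2 : ℝ)⁻¹)).tendsto 0 |>.comp h1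
  rw [ENNReal.zero_rpow_of_pos (by norm_num)] at h2
  refine h2.congr fun n => ?_
  rw [Function.comp_apply, ← ENNReal.rpow_two, ← ENNReal.rpow_mul]
  norm_num

/-- Smooth approximations that converge also on almost every sphere. -/
lemma exists_smooth_approx_seq {d : ℕ} [Nontrivial (Eu d)] {R R' : ℝ} (hRR : R' < R) {v : Eu d → ℝ}
    {g : Eu d → Eu d} (hv : MemLp v 2 (volume.restrict (ball 0 R)))
    (hg : MemLp g 2 (volume.restrict (ball 0 R))) (h : HasWeakGrad (ball 0 R) v g) :
    ∃ φ : ℕ → Eu d → ℝ, (∀ n, ContDiff ℝ ∞ (φ n)) ∧ (∀ n, HasCompactSupport (φ n)) ∧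
      Tendsto (fun n => eLpNorm (φ n - v) 2 (volume.restrict (ball 0 R'))) atTop (𝓝 0) ∧
      Tendsto (fun n => eLpNorm (gradient (φ n) - g) 2 (volume.restrict (ball 0 R'))) atTop (𝓝 0) ∧
      ∀ᵐ s : ℝ, s ∈ Ioo 0 R' →
        Tendsto (fun n => eLpNorm (fun θ => φ n (s • θ) - v (s • θ)) 2 (sphereMeasure d))
          atTop (𝓝 0) ∧
        Tendsto (fun n => eLpNorm (fun θ => gradient (φ n) (s • θ) - g (s • θ)) 2
          (sphereMeasure d)) atTop (𝓝 0) := by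
  -- Geometric errors have summable squares, which is what convergence on almost every sphere
  -- requires.
  have hε : ∀ n : ℕ, (0 : ENNReal) < 2⁻¹ ^ n := fun n =>
    ENNReal.pow_pos (ENNReal.inv_pos.2 (by simp)) n
  choose φ h1 h2 h3 h4 using fun n => exists_smooth_approx hRR hv hg h (hε n)
  have hle : volume.restrict (ball (0 : Eu d) R') ≤ volume.restrict (ball 0 R) :=
    Measure.restrict_mono (ball_subset_ball hRR.le) le_rfl
  have hgeo : Tendsto (fun n : ℕ => (2⁻¹ : ENNReal) ^ n) atTop (𝓝 0) :=
    ENNReal.tendsto_pow_atTop_nhds_zero_of_lt_one (ENNReal.inv_lt_one.2 (by norm_num))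
  have hsq : ∀ {a : ℕ → ENNReal}, (∀ n, a n ≤ 2⁻¹ ^ n) → ∑' n, a n ^ 2 ≠ ⊤ := by
    intro a ha
    refine ne_top_of_le_ne_top (b := ∑' n : ℕ, (2⁻¹ : ENNReal) ^ n) ?_
      (ENNReal.tsum_le_tsum fun n => ?_)
    · rw [ENNReal.tsum_geometric]
      simp
    · calc a n ^ 2 ≤ (2⁻¹ ^ n) ^ 2 := by gcongr; exact ha n
        _ = 2⁻¹ ^ n * 2⁻¹ ^ n := sq _
        _ ≤ 2⁻¹ ^ n * 1 := by
          gcongr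
          exact pow_le_one₀ zero_le (ENNReal.inv_le_one.2 (by norm_num))
        _ = 2⁻¹ ^ n := mul_one _
  refine ⟨φ, h1, h2, ?_, ?_, ?_⟩
  · exact tendsto_of_tendsto_of_tendsto_of_le_of_le tendsto_const_nhds hgeo (fun _ => zero_le) h3
  · exact tendsto_of_tendsto_of_tendsto_of_le_of_le tendsto_const_nhds hgeo (fun _ => zero_le) h4
  · filter_upwards [tendsto_eLpNorm_sphere_of_tsum (fun n =>
        ((h1 n).continuous.aestronglyMeasurable.sub (hv.mono_measure hle).1)) (hsq h3),
      tendsto_eLpNorm_sphere_of_tsum (fun n =>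
        ((continuous_gradient (h1 n)).aestronglyMeasurable.sub (hg.mono_measure hle).1)) (hsq h4)]
      with s hs1 hs2 hs
    exact ⟨hs1 hs, hs2 hs⟩

/-! ### One-homogeneous extensions -/

/-- The gradient on the unit sphere of the one-homogeneous extension of a function with values
`v` and gradient `g` on the unit sphere. -/
def homGrad {d : ℕ} (v : Eu d → ℝ) (g : Eu d → Eu d) (θ : Eu d) : Eu d :=
  v θ • θ + (g θ - inner ℝ (g θ) θ • θ)

lemma memLp_ball_normalize {d : ℕ} [Nontrivial (Eu d)] (hd : 0 < d) {F : Type*}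
    [NormedAddCommGroup F] {f : Eu d → F} (hf : MemLp f 2 (sphereMeasure d)) :
    MemLp (fun x => f (‖x‖⁻¹ • x)) 2 (volume.restrict (ball (0 : Eu d) 1)) := by
  have h1 : MemLp f 2 ((volume.restrict (ball (0 : Eu d) 1)).map (fun x => ‖x‖⁻¹ • x)) := by
    rw [map_normalize_ball hd]
    exact hf.smul_measure (by simp)
  exact h1.comp_of_map (by fun_prop)

lemma eLpNorm_ball_normalize {d : ℕ} [Nontrivial (Eu d)] (hd : 0 < d) {F : Type*}
    [NormedAddCommGroup F] {f : Eu d → F} (hf : AEStronglyMeasurable f (sphereMeasure d)) :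
    eLpNorm (fun x => f (‖x‖⁻¹ • x)) 2 (volume.restrict (ball (0 : Eu d) 1)) =
      ENNReal.ofReal (1 / d) ^ (1 / (2 : ENNReal)).toReal * eLpNorm f 2 (sphereMeasure d) := by
  have h1 : AEStronglyMeasurable f
      ((volume.restrict (ball (0 : Eu d) 1)).map (fun x => ‖x‖⁻¹ • x)) := by
    rw [map_normalize_ball hd]
    exact hf.smul_measure _
  have h2 := eLpNorm_map_measure (p := 2) h1 (by fun_prop)
  rw [map_normalize_ball hd, eLpNorm_smul_measure_of_ne_top (by simp)] at h2
  exact h2.symm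

lemma integral_ball_normalize {d : ℕ} [Nontrivial (Eu d)] (hd : 0 < d) {f : Eu d → ℝ}
    (hf : AEStronglyMeasurable f (sphereMeasure d)) :
    ∫ x in ball (0 : Eu d) 1, f (‖x‖⁻¹ • x) = 1 / d * ∫ x, f x ∂(sphereMeasure d) := by
  have h1 : AEStronglyMeasurable f
      ((volume.restrict (ball (0 : Eu d) 1)).map (fun x => ‖x‖⁻¹ • x)) := by
    rw [map_normalize_ball hd]
    exact hf.smul_measure _
  rw [← integral_map (by fun_prop) h1, map_normalize_ball hd, integral_smul_measure,
    ENNReal.toReal_ofReal (by positivity), smul_eq_mul]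

lemma tendsto_eLpNorm_ball_normalize {d : ℕ} [Nontrivial (Eu d)] (hd : 0 < d) {F : Type*}
    [NormedAddCommGroup F] {f : ℕ → Eu d → F}
    (hf : ∀ n, AEStronglyMeasurable (f n) (sphereMeasure d))
    (h : Tendsto (fun n => eLpNorm (f n) 2 (sphereMeasure d)) atTop (𝓝 0)) :
    Tendsto (fun n => eLpNorm (fun x => f n (‖x‖⁻¹ • x)) 2 (volume.restrict (ball (0 : Eu d) 1)))
      atTop (𝓝 0) := by
  have h1 := ENNReal.Tendsto.const_mul
    (a := ENNReal.ofReal (1 / d) ^ (1 / (2 : ENNReal)).toReal) h (Or.inr (by simp))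
  rw [mul_zero] at h1
  exact h1.congr fun n => (eLpNorm_ball_normalize hd (hf n)).symm

lemma aestronglyMeasurable_homGrad {d : ℕ} {v : Eu d → ℝ} {g : Eu d → Eu d} {μ : Measure (Eu d)}
    (hv : AEStronglyMeasurable v μ) (hg : AEStronglyMeasurable g μ) :
    AEStronglyMeasurable (homGrad v g) μ :=
  (hv.smul aestronglyMeasurable_id).add (hg.sub
    ((hg.inner (𝕜 := ℝ) (aestronglyMeasurable_id (μ := μ))).smul
      (aestronglyMeasurable_id (μ := μ))))

lemma norm_homGrad_le {d : ℕ} (v : Eu d → ℝ) (g : Eu d → Eu d) {θ : Eu d} (hθ : ‖θ‖ = 1) :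
    ‖homGrad v g θ‖ ≤ ‖v θ‖ + 2 * ‖g θ‖ := by
  have h1 : ‖inner ℝ (g θ) θ • θ‖ ≤ ‖g θ‖ := by
    rw [norm_smul, hθ, mul_one]
    simpa [hθ] using norm_inner_le_norm (𝕜 := ℝ) (g θ) θ
  calc _ ≤ ‖v θ • θ‖ + ‖g θ - inner ℝ (g θ) θ • θ‖ := norm_add_le _ _
    _ ≤ ‖v θ‖ + (‖g θ‖ + ‖inner ℝ (g θ) θ • θ‖) := by
      rw [norm_smul, hθ, mul_one]
      gcongr
      exact norm_sub_le _ _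
    _ ≤ _ := by linarith

/-- The radial vector `v θ` is orthogonal to the tangential projection of `g`, whose squared length
is `|g|² - (g·θ)²`. This is how the radial derivative enters the energy of the one-homogeneous
extension. -/
lemma norm_homGrad_sq {d : ℕ} (v : Eu d → ℝ) (g : Eu d → Eu d) {θ : Eu d} (hθ : ‖θ‖ = 1) :
    ‖homGrad v g θ‖ ^ 2 = v θ ^ 2 + ‖g θ‖ ^ 2 - inner ℝ (g θ) θ ^ 2 := by
  have h0 : inner ℝ θ θ = (1 : ℝ) := by rw [real_inner_self_eq_norm_sq, hθ, one_pow]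
  rw [← real_inner_self_eq_norm_sq, homGrad]
  simp only [inner_add_left, inner_add_right, inner_sub_left, inner_sub_right, inner_smul_left,
    inner_smul_right, h0, real_inner_comm, conj_trivial, real_inner_self_eq_norm_sq]
  ring

lemma memLp_homGrad {d : ℕ} {v : Eu d → ℝ} {g : Eu d → Eu d} (hv : MemLp v 2 (sphereMeasure d))
    (hg : MemLp g 2 (sphereMeasure d)) : MemLp (homGrad v g) 2 (sphereMeasure d) := by
  refine (hv.norm.add (hg.norm.const_mul 2)).mono (aestronglyMeasurable_homGrad hv.1 hg.1) ?_
  filter_upwards [ae_norm_sphereMeasure d] with θ hθ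
  exact (norm_homGrad_le v g hθ).trans (le_abs_self _)

lemma homGrad_sub {d : ℕ} (v v' : Eu d → ℝ) (g g' : Eu d → Eu d) :
    homGrad v g - homGrad v' g' = homGrad (v - v') (g - g') := by
  funext θ
  simp only [homGrad, Pi.sub_apply, sub_smul, inner_sub_left]
  abel

lemma eLpNorm_homGrad_le {d : ℕ} {v : Eu d → ℝ} {g : Eu d → Eu d}
    (hv : AEStronglyMeasurable v (sphereMeasure d))
    (hg : AEStronglyMeasurable g (sphereMeasure d)) :
    eLpNorm (homGrad v g) 2 (sphereMeasure d) ≤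
      eLpNorm v 2 (sphereMeasure d) + 2 * eLpNorm g 2 (sphereMeasure d) := by
  calc _ ≤ eLpNorm ((fun θ => ‖v θ‖) + (2 : ℝ) • fun θ => ‖g θ‖) 2 (sphereMeasure d) := by
        refine eLpNorm_mono_ae ?_
        filter_upwards [ae_norm_sphereMeasure d] with θ hθ
        exact (norm_homGrad_le v g hθ).trans (le_abs_self _)
    _ ≤ eLpNorm (fun θ => ‖v θ‖) 2 (sphereMeasure d) +
        eLpNorm ((2 : ℝ) • fun θ => ‖g θ‖) 2 (sphereMeasure d) :=
        eLpNorm_add_le hv.norm (hg.norm.const_smul _) one_le_two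
    _ = _ := by
        rw [eLpNorm_const_smul, eLpNorm_norm, eLpNorm_norm]
        congr 2
        simp [enorm_eq_nnnorm]

lemma norm_normalize_le {d : ℕ} (x : Eu d) : ‖‖x‖⁻¹ • x‖ ≤ 1 := by
  rw [norm_smul, norm_inv, norm_norm]
  exact inv_mul_le_one

/-- The Lipschitz constant of `x ↦ x/|x|` blows up at the origin like the inverse of the distance;
the factor `‖y‖` compensates for this. -/
lemma norm_mul_dist_normalize_le {d : ℕ} {x y : Eu d} (hx : x ≠ 0) (hy : y ≠ 0) :
    ‖y‖ * ‖‖x‖⁻¹ • x - ‖y‖⁻¹ • y‖ ≤ 2 * ‖x - y‖ := by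
  have hx' : ‖x‖ ≠ 0 := norm_ne_zero_iff.2 hx
  have hy' : ‖y‖ ≠ 0 := norm_ne_zero_iff.2 hy
  have h1 : ‖y‖ • (‖x‖⁻¹ • x - ‖y‖⁻¹ • y) = (‖y‖ - ‖x‖) • (‖x‖⁻¹ • x) + (x - y) := by
    rw [smul_sub, smul_smul ‖y‖ ‖y‖⁻¹, mul_inv_cancel₀ hy', one_smul, sub_smul,
      smul_smul ‖x‖ ‖x‖⁻¹, mul_inv_cancel₀ hx', one_smul]
    abel
  calc ‖y‖ * ‖‖x‖⁻¹ • x - ‖y‖⁻¹ • y‖ = ‖‖y‖ • (‖x‖⁻¹ • x - ‖y‖⁻¹ • y)‖ := by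
        rw [norm_smul, norm_norm]
    _ ≤ ‖(‖y‖ - ‖x‖) • (‖x‖⁻¹ • x)‖ + ‖x - y‖ := by rw [h1]; exact norm_add_le _ _
    _ ≤ ‖x - y‖ * 1 + ‖x - y‖ := by
        rw [norm_smul]
        gcongr
        · rw [Real.norm_eq_abs, abs_sub_comm]
          exact abs_norm_sub_norm_le x y
        · exact norm_normalize_le x
    _ = _ := by ring

/-- The change of the factor `|x|` costs the bound `B`, and the change of direction costs `2 C` by
`norm_mul_dist_normalize_le`. The origin is treated apart, since the normalization is not continuous
there. -/
lemma lipschitzWith_oneHomExt {d : ℕ} {w : Eu d → ℝ} {C : ℝ≥0} (hw : LipschitzWith C w)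
    {B : ℝ} (hB : ∀ x, ‖w x‖ ≤ B) : ∃ K, LipschitzWith K (oneHomExt w) := by
  have hB0 : 0 ≤ B := (norm_nonneg _).trans (hB 0)
  refine ⟨Real.toNNReal (B + 2 * C), LipschitzWith.of_dist_le_mul fun x y => ?_⟩
  rw [Real.coe_toNNReal _ (by positivity), dist_eq_norm, dist_eq_norm]
  have hbd : ∀ x, ‖oneHomExt w x‖ ≤ B * ‖x‖ := fun x => by
    rw [oneHomExt, norm_mul, norm_norm, mul_comm]
    gcongr
    exact hB _
  have hC : 0 ≤ (2 * C : ℝ) := by positivity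
  by_cases hx : x = 0
  · subst hx
    have h0 : oneHomExt w 0 = 0 := by simp [oneHomExt]
    rw [h0, zero_sub, zero_sub, norm_neg, norm_neg]
    exact (hbd y).trans (by gcongr; linarith)
  by_cases hy : y = 0
  · subst hy
    have h0 : oneHomExt w 0 = 0 := by simp [oneHomExt]
    rw [h0, sub_zero, sub_zero]
    exact (hbd x).trans (by gcongr; linarith)
  have h1 : oneHomExt w x - oneHomExt w y =
      (‖x‖ - ‖y‖) * w (‖x‖⁻¹ • x) + ‖y‖ * (w (‖x‖⁻¹ • x) - w (‖y‖⁻¹ • y)) := by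
    simp only [oneHomExt]
    ring
  rw [h1]
  calc _ ≤ ‖(‖x‖ - ‖y‖) * w (‖x‖⁻¹ • x)‖ + ‖‖y‖ * (w (‖x‖⁻¹ • x) - w (‖y‖⁻¹ • y))‖ :=
        norm_add_le _ _
    _ ≤ ‖x - y‖ * B + ‖y‖ * (C * ‖‖x‖⁻¹ • x - ‖y‖⁻¹ • y‖) := by
        rw [norm_mul, norm_mul, norm_norm]
        gcongr
        · exact abs_norm_sub_norm_le x y
        · exact hB _
        · exact hw.norm_sub_le _ _
    _ = B * ‖x - y‖ + C * (‖y‖ * ‖‖x‖⁻¹ • x - ‖y‖⁻¹ • y‖) := by ring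
    _ ≤ B * ‖x - y‖ + C * (2 * ‖x - y‖) := by
        exact add_le_add_right
          (mul_le_mul_of_nonneg_left (norm_mul_dist_normalize_le hx hy) C.coe_nonneg) _
    _ = _ := by ring

/-- The point `x/|x|` is constant along rays, so only the tangential part of the gradient of `w`
survives; the radial derivative is `w (x/|x|)`, from the factor `|x|`. -/
lemma hasGradientAt_oneHomExt {d : ℕ} {w : Eu d → ℝ} (hw : Differentiable ℝ w) {x : Eu d}
    (hx : x ≠ 0) :
    HasGradientAt (oneHomExt w) (homGrad w (gradient w) (‖x‖⁻¹ • x)) x := by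
  have hx' : ‖x‖ ≠ 0 := norm_ne_zero_iff.2 hx
  have h1 := hasFDerivAt_norm_of_ne_zero hx
  have h2 : HasFDerivAt (fun y : Eu d => ‖y‖⁻¹) (-(‖x‖ ^ 2)⁻¹ • (‖x‖⁻¹ • innerSL ℝ x)) x :=
    (hasDerivAt_inv hx').comp_hasFDerivAt x h1
  have h3 : HasFDerivAt (fun y : Eu d => ‖y‖⁻¹ • y) _ x := h2.smul (hasFDerivAt_id x)
  have h4 : HasFDerivAt (fun y : Eu d => w (‖y‖⁻¹ • y)) _ x :=
    HasFDerivAt.comp (g := w) x (hw (‖x‖⁻¹ • x)).hasGradientAt.hasFDerivAt h3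
  have h5 := h1.mul h4
  rw [hasGradientAt_iff_hasFDerivAt]
  refine h5.congr_fderiv ?_
  ext e
  simp only [homGrad, add_apply, smul_apply,
    ContinuousLinearMap.comp_apply, InnerProductSpace.toDual_apply_apply, innerSL_apply_apply,
    ContinuousLinearMap.smulRight_apply, ContinuousLinearMap.id_apply, smul_eq_mul,
    inner_add_left, inner_sub_left, inner_smul_left, inner_add_right, inner_smul_right,
    conj_trivial]
  field_simp
  ring

/-! ### Rescalings -/

lemma contDiff_rescale {d : ℕ} {φ : Eu d → ℝ} (hφ : ContDiff ℝ ∞ φ) (r : ℝ) :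
    ContDiff ℝ ∞ fun x => 1 / r * φ (r • x) := by
  have h : ContDiff ℝ ∞ fun x : Eu d => r • x := contDiff_id.const_smul r
  exact contDiff_const.mul (hφ.comp h)

lemma hasCompactSupport_rescale {d : ℕ} {φ : Eu d → ℝ} (hφ : HasCompactSupport φ) {r : ℝ}
    (hr : 0 < r) : HasCompactSupport fun x => 1 / r * φ (r • x) :=
  (hφ.comp_homeomorph (Homeomorph.smulOfNeZero r hr.ne')).mul_left

lemma gradient_rescale {d : ℕ} {φ : Eu d → ℝ} (hφ : ContDiff ℝ ∞ φ) {r : ℝ} (hr : 0 < r) :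
    gradient (fun x => 1 / r * φ (r • x)) = fun x => gradient φ (r • x) := by
  funext x
  have h1 : HasFDerivAt (fun y : Eu d => r • y) (r • ContinuousLinearMap.id ℝ (Eu d)) x :=
    (hasFDerivAt_id x).const_smul r
  have h2 := (HasFDerivAt.comp (g := φ) x
    ((hφ.differentiable (by simp)) (r • x)).hasGradientAt.hasFDerivAt h1).const_mul (1 / r)
  refine HasGradientAt.gradient (hasGradientAt_iff_hasFDerivAt.2 (h2.congr_fderiv ?_))
  ext e
  simp [hr.ne']

lemma tendsto_eLpNorm_const_mul {X : Type*} [MeasurableSpace X] {μ : Measure X} (c : ℝ)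
    {f : ℕ → X → ℝ} {f₀ : X → ℝ}
    (h : Tendsto (fun n => eLpNorm (f n - f₀) 2 μ) atTop (𝓝 0)) :
    Tendsto (fun n => eLpNorm ((fun x => c * f n x) - fun x => c * f₀ x) 2 μ) atTop (𝓝 0) := by
  have h1 := ENNReal.Tendsto.const_mul (a := ‖c‖ₑ) h (Or.inr (by simp))
  rw [mul_zero] at h1
  refine h1.congr fun n => ?_
  rw [← eLpNorm_const_smul]
  congr 1
  funext x
  simp [mul_sub]

/-- Every rescaling has a trace, whose square integral is an integral over the ball. -/
lemma exists_greenTriple_rescale {d : ℕ} [Nontrivial (Eu d)] {R : ℝ} {v : Eu d → ℝ}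
    {g : Eu d → Eu d} (hv : MemLp v 2 (volume.restrict (ball 0 R)))
    (hg : MemLp g 2 (volume.restrict (ball 0 R))) (h : HasWeakGrad (ball 0 R) v g) {r : ℝ}
    (hr : r ∈ Ioo 0 R) :
    ∃ T, GreenTriple (fun x => 1 / r * v (r • x)) (fun x => g (r • x)) T ∧
      ∫ x, T x ^ 2 ∂(sphereMeasure d) =
        ∫ x in ball (0 : Eu d) 1, (d * (1 / r * v (r • x)) ^ 2 +
          2 * (1 / r * v (r • x)) * inner ℝ (g (r • x)) x) := by
  have hle : volume.restrict (ball (0 : Eu d) r) ≤ volume.restrict (ball 0 R) :=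
    Measure.restrict_mono (ball_subset_ball hr.2.le) le_rfl
  obtain ⟨φ, h1, h2, h3, h4, -⟩ := exists_smooth_approx_seq hr.2 hv hg h
  have h5 := tendsto_eLpNorm_const_mul (1 / r) (tendsto_eLpNorm_ball_scale hr.1 h3)
  have h6 := tendsto_eLpNorm_ball_scale hr.1 h4
  obtain ⟨T, hT, hT', -⟩ := exists_greenTriple (fun n => contDiff_rescale (h1 n) r)
    (fun n => hasCompactSupport_rescale (h2 n) hr.1)
    ((memLp_ball_scale hr.1 (hv.mono_measure hle)).const_mul (1 / r))
    (memLp_ball_scale hr.1 (hg.mono_measure hle)) h5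
    (by simpa only [gradient_rescale (h1 _) hr.1] using h6)
  exact ⟨T, hT, hT'⟩

/-- If smooth functions converge in `L²` of the sphere together with their gradients, then so do
their one-homogeneous extensions in `H¹` of the ball. -/
lemma greenTriple_oneHomExt {d : ℕ} [Nontrivial (Eu d)] (hd : 0 < d) {w : ℕ → Eu d → ℝ}
    (hw : ∀ n, ContDiff ℝ ∞ (w n)) (hc : ∀ n, HasCompactSupport (w n)) {v : Eu d → ℝ}
    {g : Eu d → Eu d} (hv : MemLp v 2 (sphereMeasure d)) (hg : MemLp g 2 (sphereMeasure d))
    (tv : Tendsto (fun n => eLpNorm (w n - v) 2 (sphereMeasure d)) atTop (𝓝 0))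
    (tg : Tendsto (fun n => eLpNorm (gradient (w n) - g) 2 (sphereMeasure d)) atTop (𝓝 0)) :
    GreenTriple (oneHomExt v) (fun x => homGrad v g (‖x‖⁻¹ • x)) v := by
  have hwm : ∀ n, MemLp (w n) 2 (sphereMeasure d) := fun n =>
    memLp_two_sphere_of_continuous (hw n).continuous
  have hgm : ∀ n, MemLp (gradient (w n)) 2 (sphereMeasure d) := fun n =>
    memLp_two_sphere_of_continuous (continuous_gradient (hw n))
  have hsphere : ∀ f : Eu d → ℝ, oneHomExt f =ᵐ[sphereMeasure d] f := fun f => by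
    filter_upwards [ae_norm_sphereMeasure d] with θ hθ
    simp [oneHomExt, hθ]
  have hG : ∀ n, GreenTriple (oneHomExt (w n))
      (fun x => homGrad (w n) (gradient (w n)) (‖x‖⁻¹ • x)) (oneHomExt (w n)) := fun n => by
    obtain ⟨D, hD⟩ := ContDiff.lipschitzWith_of_hasCompactSupport (hc n) (hw n) (by simp)
    obtain ⟨B, hB⟩ := (hc n).exists_bound_of_continuous (hw n).continuous
    obtain ⟨K, hK⟩ := lipschitzWith_oneHomExt hD hB
    exact GreenTriple.of_lipschitz hK
      (fun x hx => hasGradientAt_oneHomExt ((hw n).differentiable (by simp)) hx)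
      (memLp_ball_normalize hd (memLp_homGrad (hwm n) (hgm n)))
  have hmul : ∀ f : Eu d → ℝ, ∀ᵐ x ∂(volume.restrict (ball (0 : Eu d) 1)),
      ‖oneHomExt f x‖ ≤ ‖f (‖x‖⁻¹ • x)‖ := fun f => by
    filter_upwards [ae_restrict_mem measurableSet_ball] with x hx
    rw [oneHomExt, norm_mul, norm_norm]
    exact mul_le_of_le_one_left (norm_nonneg _) (mem_ball_zero_iff.1 hx).le
  have hz : MemLp (oneHomExt v) 2 (volume.restrict (ball 0 1)) :=
    (memLp_ball_normalize hd hv).mono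
      (continuous_norm.aestronglyMeasurable.mul (memLp_ball_normalize hd hv).1) (hmul v)
  -- The Lipschitz constants of the approximating extensions may blow up. Only `L²` convergence on
  -- the sphere is used, carried to the ball by the projection `x ↦ x/|x|`.
  refine GreenTriple.of_tendsto hG hz (memLp_ball_normalize hd (memLp_homGrad hv hg)) hv
    ?_ ?_ ?_
  · refine tendsto_of_tendsto_of_tendsto_of_le_of_le tendsto_const_nhds
      (tendsto_eLpNorm_ball_normalize hd (fun n => (hwm n).1.sub hv.1) tv) (fun _ => zero_le)
      fun n => eLpNorm_mono_ae ?_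
    filter_upwards [hmul (w n - v)] with x hx
    refine le_trans (le_of_eq ?_) hx
    simp [oneHomExt, mul_sub]
  · refine tendsto_eLpNorm_ball_normalize hd (f := fun n =>
      homGrad (w n) (gradient (w n)) - homGrad v g) (fun n =>
        (memLp_homGrad (hwm n) (hgm n)).1.sub (memLp_homGrad hv hg).1) ?_
    have h1 := tv.add (ENNReal.Tendsto.const_mul (a := 2) tg (Or.inr (by simp)))
    rw [mul_zero, add_zero] at h1
    refine tendsto_of_tendsto_of_tendsto_of_le_of_le tendsto_const_nhds h1 (fun _ => zero_le)
      fun n => ?_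
    rw [homGrad_sub]
    exact eLpNorm_homGrad_le ((hwm n).1.sub hv.1) ((hgm n).1.sub hg.1)
  · refine tv.congr fun n => eLpNorm_congr_ae ?_
    exact (hsphere (w n)).symm.sub EventuallyEq.rfl

/-- The gap between `R'` and `R` is the room for mollification. At a radius where the approximations
and their gradients converge on the sphere, one sequence gives both triples, with the pointwise
restriction as common trace. -/
lemma ae_greenTriple_of_lt {d : ℕ} [Nontrivial (Eu d)] (hd : 0 < d) {R R' : ℝ} (hRR : R' < R)
    {v : Eu d → ℝ} {g : Eu d → Eu d} (hv : MemLp v 2 (volume.restrict (ball 0 R)))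
    (hg : MemLp g 2 (volume.restrict (ball 0 R))) (h : HasWeakGrad (ball 0 R) v g) :
    ∀ᵐ r : ℝ, r ∈ Ioo 0 R' →
      MemLp (fun x => 1 / r * v (r • x)) 2 (sphereMeasure d) ∧
      MemLp (fun x => g (r • x)) 2 (sphereMeasure d) ∧
      GreenTriple (fun x => 1 / r * v (r • x)) (fun x => g (r • x))
        (fun x => 1 / r * v (r • x)) ∧
      GreenTriple (oneHomExt fun x => 1 / r * v (r • x))
        (fun x => homGrad (fun x => 1 / r * v (r • x)) (fun x => g (r • x)) (‖x‖⁻¹ • x))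
        (fun x => 1 / r * v (r • x)) := by
  obtain ⟨φ, h1, h2, h3, h4, h5⟩ := exists_smooth_approx_seq hRR hv hg h
  filter_upwards [h5, memLp_sphere_of_ball hv, memLp_sphere_of_ball hg] with r h5 hvs hgs hr
  have hle : volume.restrict (ball (0 : Eu d) r) ≤ volume.restrict (ball 0 R) :=
    Measure.restrict_mono (ball_subset_ball (hr.2.trans hRR).le) le_rfl
  have hle' : volume.restrict (ball (0 : Eu d) r) ≤ volume.restrict (ball 0 R') :=
    Measure.restrict_mono (ball_subset_ball hr.2.le) le_rfl
  have hvs' := (hvs ⟨hr.1, hr.2.trans hRR⟩).const_mul (1 / r)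
  have hgs' := hgs ⟨hr.1, hr.2.trans hRR⟩
  have tv := tendsto_eLpNorm_const_mul (f := fun n θ => φ n (r • θ)) (f₀ := fun θ => v (r • θ))
    (1 / r) (h5 hr).1
  have tg := (h5 hr).2
  have hw := fun n => contDiff_rescale (h1 n) r
  have hwc := fun n => hasCompactSupport_rescale (h2 n) hr.1
  have htrans : ∀ {F : Type} [NormedAddCommGroup F] {a : ℕ → Eu d → F} {b : Eu d → F},
      Tendsto (fun n => eLpNorm (a n - b) 2 (volume.restrict (ball 0 R'))) atTop (𝓝 0) →
      Tendsto (fun n => eLpNorm (a n - b) 2 (volume.restrict (ball 0 r))) atTop (𝓝 0) := by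
    intro F _ a b hab
    exact tendsto_of_tendsto_of_tendsto_of_le_of_le tendsto_const_nhds hab (fun _ => zero_le)
      fun n => eLpNorm_mono_measure _ hle'
  have h6 := tendsto_eLpNorm_const_mul (1 / r) (tendsto_eLpNorm_ball_scale hr.1 (htrans h3))
  have h7 := tendsto_eLpNorm_ball_scale hr.1 (htrans h4)
  have hgr : ∀ n, (fun x => gradient (φ n) (r • x)) =
      gradient (fun x => 1 / r * φ n (r • x)) := fun n => (gradient_rescale (h1 n) hr.1).symm
  simp only [hgr] at h7
  refine ⟨hvs', hgs', ?_, ?_⟩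
  · exact GreenTriple.of_tendsto (fun n => GreenTriple.of_contDiff (hw n) (hwc n))
      ((memLp_ball_scale hr.1 (hv.mono_measure hle)).const_mul (1 / r))
      (memLp_ball_scale hr.1 (hg.mono_measure hle)) hvs' h6 h7 tv
  · refine greenTriple_oneHomExt hd hw hwc hvs' hgs' tv ?_
    simp only [gradient_rescale (h1 _) hr.1]
    exact tg

/-- On almost every sphere the rescaling and its one-homogeneous extension have the restriction
to the sphere as their trace. -/
lemma ae_greenTriple {d : ℕ} [Nontrivial (Eu d)] (hd : 0 < d) {R : ℝ}
    {v : Eu d → ℝ} {g : Eu d → Eu d} (hv : MemLp v 2 (volume.restrict (ball 0 R)))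
    (hg : MemLp g 2 (volume.restrict (ball 0 R))) (h : HasWeakGrad (ball 0 R) v g) :
    ∀ᵐ r : ℝ, r ∈ Ioo 0 R →
      MemLp (fun x => 1 / r * v (r • x)) 2 (sphereMeasure d) ∧
      MemLp (fun x => g (r • x)) 2 (sphereMeasure d) ∧
      GreenTriple (fun x => 1 / r * v (r • x)) (fun x => g (r • x))
        (fun x => 1 / r * v (r • x)) ∧
      GreenTriple (oneHomExt fun x => 1 / r * v (r • x))
        (fun x => homGrad (fun x => 1 / r * v (r • x)) (fun x => g (r • x)) (‖x‖⁻¹ • x))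
        (fun x => 1 / r * v (r • x)) := by
  -- Rational radii `q < R` exhaust `(0, R)`, so the exceptional set is a countable union of null
  -- sets.
  have h1 : ∀ q : {q : ℚ // (q : ℝ) < R}, _ := fun q => ae_greenTriple_of_lt hd q.2 hv hg h
  filter_upwards [ae_all_iff.2 h1] with r hr hrR
  obtain ⟨q, hq1, hq2⟩ := exists_rat_btwn hrR.2
  exact hr ⟨q, hq2⟩ ⟨hrR.1, hq1⟩

/-! ### The nonlinearity and the domain -/

/-- For `t ≥ 0` convexity gives `F' t ≥ F' 0 ≥ -F₀`, and `F'' ≤ F₀` gives `F' t ≤ F' 0 + F₀ t ≤ F₀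
t`. -/
lemma IsNonlinearity.abs_deriv_le {F : ℝ → ℝ} {β : ℝ≥0} {F₀ : ℝ} (hF : IsNonlinearity F β F₀)
    (t : ℝ) : |deriv F t| ≤ F₀ * (1 + |t|) := by
  have hd : Differentiable ℝ F := hF.contDiff.differentiable (by simp)
  have hd2 : Differentiable ℝ (deriv F) :=
    ((contDiff_succ_iff_deriv (n := 1)).1 hF.contDiff).2.2.differentiable (by simp)
  have h0 := hF.nonneg
  rcases le_total t 0 with ht | ht
  · obtain ⟨h1, h2⟩ := hF.deriv_mem t ht
    rw [abs_le]
    have := mul_nonneg h0 (abs_nonneg t)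
    constructor <;> linarith
  · have h1 : deriv F 0 ≤ deriv F t :=
      hF.convex.monotoneOn_deriv (fun x _ => hd x) (mem_univ 0) (mem_univ t) ht
    have h2 := image_sub_le_mul_sub_of_deriv_le hd2 hF.deriv2_le ht
    obtain ⟨h3, h4⟩ := hF.deriv_mem 0 le_rfl
    have := mul_nonneg h0 ht
    rw [abs_of_nonneg ht, abs_le]
    constructor <;> linarith

/-- The mean value inequality starting from `F 0 = 0`. Quadratic growth is what makes `F` of an `L²`
function integrable on a finite measure space. -/
lemma IsNonlinearity.abs_le {F : ℝ → ℝ} {β : ℝ≥0} {F₀ : ℝ} (hF : IsNonlinearity F β F₀)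
    (t : ℝ) : |F t| ≤ 2 * F₀ * (1 + t ^ 2) := by
  have hd : Differentiable ℝ F := hF.contDiff.differentiable (by simp)
  have h0 := hF.nonneg
  have h1 := (convex_Icc (-|t|) |t|).norm_image_sub_le_of_norm_deriv_le (f := F)
    (C := F₀ * (1 + |t|)) (x := 0) (y := t) (fun x _ => hd x) (fun x hx => by
      have h2 : |x| ≤ |t| := _root_.abs_le.2 hx
      refine (hF.abs_deriv_le x).trans ?_
      gcongr) (by simp) (_root_.abs_le.1 le_rfl)
  rw [hF.zero, sub_zero, sub_zero, Real.norm_eq_abs, Real.norm_eq_abs] at h1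
  refine h1.trans ?_
  have h3 : (1 + |t|) * |t| ≤ 2 * (1 + t ^ 2) := by
    nlinarith [sq_abs t, sq_nonneg (|t| - 1)]
  nlinarith

lemma IsNonlinearity.integrable_comp {F : ℝ → ℝ} {β : ℝ≥0} {F₀ : ℝ} (hF : IsNonlinearity F β F₀)
    {X : Type*} [MeasurableSpace X] {μ : Measure X} [IsFiniteMeasure μ] {v : X → ℝ}
    (hv : MemLp v 2 μ) : Integrable (fun x => F (v x)) μ := by
  have h1 : Integrable (fun x => 2 * F₀ * (1 + v x ^ 2)) μ :=
    ((integrable_const 1).add hv.integrable_sq).const_mul _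
  exact h1.mono' (hF.contDiff.continuous.comp_aestronglyMeasurable hv.1)
    (ae_of_all _ fun x => hF.abs_le _)

lemma integrable_indicator_pos {X : Type*} [MeasurableSpace X] {μ : Measure X} [IsFiniteMeasure μ]
    {v q : X → ℝ} (hv : AEStronglyMeasurable v μ) (hq : AEStronglyMeasurable q μ) {C : ℝ}
    (hb : ∀ᵐ x ∂μ, ‖q x‖ ≤ C) : Integrable ({y | 0 < v y}.indicator q) μ :=
  (Integrable.of_bound hq C hb).indicator₀
    (nullMeasurableSet_lt aemeasurable_const hv.aemeasurable)

/-- The ball is connected and misses the frontier, so it is covered by the disjoint open sets `Ω`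
and the complement of the closure of `Ω`; it meets the first at its centre. -/
lemma ball_infDist_frontier_subset {d : ℕ} {Ω : Set (Eu d)} (hΩ : IsOpen Ω) {x₀ : Eu d}
    (hx₀ : x₀ ∈ Ω) : ball x₀ (infDist x₀ (frontier Ω)) ⊆ Ω := by
  -- `infDist` has the default value `0` when the frontier is empty; the ball is then empty.
  rcases le_or_gt (infDist x₀ (frontier Ω)) 0 with h | h
  · rw [ball_eq_empty.2 h]
    exact empty_subset _
  refine (convex_ball x₀ _).isPreconnected.subset_left_of_subset_union hΩ
    isClosed_closure.isOpen_compl (disjoint_compl_right.mono_left subset_closure) ?_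
    ⟨x₀, mem_ball_self h, hx₀⟩
  intro x hx
  by_contra hcon
  rw [mem_union, not_or, mem_compl_iff, not_not] at hcon
  refine disjoint_left.1 disjoint_ball_infDist hx ?_
  rw [hΩ.frontier_eq]
  exact ⟨hcon.2, hcon.1⟩

/-! ### Translation to the origin -/

lemma measurePreserving_translate_ball {d : ℕ} (x₀ : Eu d) (R : ℝ) :
    MeasurePreserving (fun y => x₀ + y) (volume.restrict (ball 0 R))
      (volume.restrict (ball x₀ R)) := by
  have h := (measurePreserving_add_left (volume : Measure (Eu d)) x₀).restrict_preimage
    (measurableSet_ball (x := x₀) (ε := R))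
  have h1 : (fun y => x₀ + y) ⁻¹' ball x₀ R = ball 0 R := by
    ext y
    simp [dist_eq_norm]
  rwa [h1] at h

/-- A translated test function is a test function in `Ω`. The integrands vanish outside the domains,
so all integrals can be taken over the whole space, where Lebesgue measure is translation invariant.
-/
lemma HasWeakGrad.translate {d : ℕ} {Ω : Set (Eu d)} {v : Eu d → ℝ} {g : Eu d → Eu d}
    (h : HasWeakGrad Ω v g) {x₀ : Eu d} {R : ℝ} (hR : ball x₀ R ⊆ Ω)
    (hv : IntegrableOn (fun y => v (x₀ + y)) (ball 0 R))
    (hg : IntegrableOn (fun y => g (x₀ + y)) (ball 0 R)) :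
    HasWeakGrad (ball 0 R) (fun y => v (x₀ + y)) (fun y => g (x₀ + y)) := by
  refine ⟨hv.locallyIntegrableOn, hg.locallyIntegrableOn, fun φ hφ hc hs e => ?_⟩
  set ψ : Eu d → ℝ := fun x => φ (x - x₀) with hψ
  have hψs : ContDiff ℝ ∞ ψ := hφ.comp (contDiff_id.sub contDiff_const)
  have hψc : HasCompactSupport ψ := by
    have := hc.comp_homeomorph (Homeomorph.addRight (-x₀))
    simpa [hψ, sub_eq_add_neg, Function.comp_def] using this
  have hψt : tsupport ψ ⊆ Ω := by
    have h1 : tsupport ψ ⊆ (fun x => x - x₀) ⁻¹' tsupport φ :=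
      tsupport_comp_subset_preimage φ (by fun_prop)
    refine (h1.trans fun x hx => ?_).trans hR
    have := hs hx
    simpa [dist_eq_norm] using this
  have hfd : ∀ y, fderiv ℝ ψ (x₀ + y) = fderiv ℝ φ y := fun y => by
    rw [hψ, fderiv_comp_sub, add_sub_cancel_left]
  have key := h.eq ψ hψs hψc hψt e
  have hz1 : ∀ x, x ∉ Ω → v x * fderiv ℝ ψ x e = 0 := fun x hx => by
    rw [image_eq_zero_of_notMem_tsupport fun hx' => hx (hψt (tsupport_fderiv_subset ℝ hx'))]
    simp
  have hz2 : ∀ x, x ∉ Ω → ψ x * inner ℝ (g x) e = 0 := fun x hx => by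
    rw [image_eq_zero_of_notMem_tsupport fun hx' => hx (hψt hx'), zero_mul]
  have hz3 : ∀ y, y ∉ ball (0 : Eu d) R → v (x₀ + y) * fderiv ℝ φ y e = 0 := fun x hx => by
    rw [image_eq_zero_of_notMem_tsupport fun hx' => hx (hs (tsupport_fderiv_subset ℝ hx'))]
    simp
  have hz4 : ∀ y, y ∉ ball (0 : Eu d) R → φ y * inner ℝ (g (x₀ + y)) e = 0 := fun x hx => by
    rw [image_eq_zero_of_notMem_tsupport fun hx' => hx (hs hx'), zero_mul]
  rw [setIntegral_eq_integral_of_forall_compl_eq_zero hz1,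
    setIntegral_eq_integral_of_forall_compl_eq_zero hz2,
    ← integral_add_left_eq_self _ x₀, ← integral_add_left_eq_self (fun x => ψ x * _) x₀] at key
  rw [setIntegral_eq_integral_of_forall_compl_eq_zero hz3,
    setIntegral_eq_integral_of_forall_compl_eq_zero hz4]
  simp only [hfd] at key
  simpa only [hψ, add_sub_cancel_left] using key

/-! ### The Weiss energy as a function of the scale -/

/-- The integrand of the functional, translated to the origin. -/
def energyDensity {d : ℕ} (F : ℝ → ℝ) (Q v : Eu d → ℝ) (g : Eu d → Eu d) (y : Eu d) : ℝ :=
  ‖g y‖ ^ 2 + F (v y) + {y | 0 < v y}.indicator (fun y => Q y ^ 2) y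

/-- The divergence of `v² x`. -/
def traceDensity {d : ℕ} (v : Eu d → ℝ) (g : Eu d → Eu d) (y : Eu d) : ℝ :=
  d * v y ^ 2 + 2 * v y * inner ℝ (g y) y

lemma rescaled_energyDensity {d : ℕ} (F : ℝ → ℝ) (Q v : Eu d → ℝ) (g : Eu d → Eu d) {r : ℝ}
    (hr : 0 < r) (x : Eu d) :
    ‖g (r • x)‖ ^ 2 + F (r * (1 / r * v (r • x))) +
      {y : Eu d | 0 < 1 / r * v (r • y)}.indicator (fun y => Q (r • y) ^ 2) x =
    energyDensity F Q v g (r • x) := by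
  have h1 : r * (1 / r * v (r • x)) = v (r • x) := by field_simp
  have h2 : 0 < 1 / r * v (r • x) ↔ 0 < v (r • x) := by
    rw [mul_pos_iff_of_pos_left (by positivity)]
  rw [energyDensity, h1]
  congr 1
  by_cases h : 0 < v (r • x)
  · rw [indicator_of_mem (show x ∈ _ from h2.2 h), indicator_of_mem (show r • x ∈ _ from h)]
  · rw [indicator_of_notMem (show x ∉ _ from fun h' => h (h2.1 h')),
      indicator_of_notMem (show r • x ∉ _ from h)]

lemma rescaled_traceDensity {d : ℕ} (v : Eu d → ℝ) (g : Eu d → Eu d) {r : ℝ}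
    (hr : 0 < r) (x : Eu d) :
    d * (1 / r * v (r • x)) ^ 2 + 2 * (1 / r * v (r • x)) * inner ℝ (g (r • x)) x =
      (r ^ 2)⁻¹ * traceDensity v g (r • x) := by
  rw [traceDensity, inner_smul_right]
  field_simp

/-- The Weiss energy at all scales, as integrals over balls. -/
lemma weissW_rescale_eq {d : ℕ} [Nontrivial (Eu d)] {R : ℝ} {u : Eu d → ℝ} {x₀ : Eu d}
    {g : Eu d → Eu d} (hv : MemLp (fun y => u (x₀ + y)) 2 (volume.restrict (ball 0 R)))
    (hg : MemLp g 2 (volume.restrict (ball 0 R)))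
    (h : HasWeakGrad (ball 0 R) (fun y => u (x₀ + y)) g) (F : ℝ → ℝ) (Q : Eu d → ℝ) {r : ℝ}
    (hr : r ∈ Ioo 0 R) :
    weissW F Q x₀ r (rescale x₀ r u) =
      (r ^ d)⁻¹ * (∫ x in ball 0 r,
        energyDensity F (fun y => Q (x₀ + y)) (fun y => u (x₀ + y)) g x) -
      (r ^ (d + 2))⁻¹ * ∫ x in ball 0 r, traceDensity (fun y => u (x₀ + y)) g x := by
  obtain ⟨T, hT, hT'⟩ := exists_greenTriple_rescale hv hg h hr
  have h1 := hT.weissW_eq F Q x₀ r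
  -- The trace term becomes an integral over the ball. The resulting formula contains no boundary
  -- value, which is why it holds at every scale.
  rw [hT'] at h1
  simp only [rescaled_traceDensity (fun y => u (x₀ + y)) g hr.1] at h1
  have h2 := fun x => rescaled_energyDensity F (fun y => Q (x₀ + y)) (fun y => u (x₀ + y)) g hr.1 x
  simp only [h2] at h1
  rw [integral_const_mul, integral_ball_scale hr.1 (energyDensity F _ _ g),
    integral_ball_scale hr.1 (traceDensity _ g)] at h1
  change weissW F Q x₀ r (fun x => 1 / r * u (x₀ + r • x)) = _
  rw [h1, pow_add]
  field_simp

/-! ### The monotonicity formula -/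

lemma corrF_eq {d : ℕ} (F : ℝ → ℝ) (r : ℝ) (v : Eu d → ℝ) :
    corrF F r v = 1 / r * (∫ x, F (r * v x) ∂(sphereMeasure d)) -
      d / r * ∫ x in ball (0 : Eu d) 1, F (r * oneHomExt v x) := by
  rw [corrF, integral_sphereMeasure]

lemma corrQ_eq {d : ℕ} (Q : Eu d → ℝ) (x₀ : Eu d) (r : ℝ) (v : Eu d → ℝ) :
    corrQ Q x₀ r v =
      1 / r * (∫ x, {y : Eu d | 0 < v y}.indicator (fun y => Q (x₀ + r • y) ^ 2) x
        ∂(sphereMeasure d)) -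
      d / r * ∫ x in ball (0 : Eu d) 1,
        {y : Eu d | 0 < oneHomExt v y}.indicator (fun y => Q (x₀ + r • y) ^ 2) x := by
  rw [corrQ, integral_sphereMeasure]

lemma memLp_inner_sphere {d : ℕ} {p : Eu d → Eu d} (hp : MemLp p 2 (sphereMeasure d)) :
    MemLp (fun x => inner ℝ x (p x)) 2 (sphereMeasure d) := by
  refine hp.mono (aestronglyMeasurable_id.inner hp.1) ?_
  filter_upwards [ae_norm_sphereMeasure d] with x hx
  simpa [hx] using norm_inner_le_norm (𝕜 := ℝ) x (p x)

/-- The Weiss energy of the one-homogeneous extension. -/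
lemma weissW_oneHomExt_eq {d : ℕ} [Nontrivial (Eu d)] (hd : 0 < d) {w : Eu d → ℝ}
    {p : Eu d → Eu d} (hw : MemLp w 2 (sphereMeasure d)) (hp : MemLp p 2 (sphereMeasure d))
    (hG : GreenTriple (oneHomExt w) (fun x => homGrad w p (‖x‖⁻¹ • x)) w) {F : ℝ → ℝ}
    {Q : Eu d → ℝ} {x₀ : Eu d} {r : ℝ}
    (hF : IntegrableOn (fun x => F (r * oneHomExt w x)) (ball 0 1))
    (hQ : IntegrableOn
      ({y : Eu d | 0 < oneHomExt w y}.indicator fun y => Q (x₀ + r • y) ^ 2) (ball 0 1)) :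
    weissW F Q x₀ r (oneHomExt w) =
      1 / d * ((∫ x, w x ^ 2 ∂(sphereMeasure d)) + (∫ x, ‖p x‖ ^ 2 ∂(sphereMeasure d)) -
        ∫ x, inner ℝ x (p x) ^ 2 ∂(sphereMeasure d)) +
      (∫ x in ball (0 : Eu d) 1, F (r * oneHomExt w x)) +
      (∫ x in ball (0 : Eu d) 1,
        {y : Eu d | 0 < oneHomExt w y}.indicator (fun y => Q (x₀ + r • y) ^ 2) x) -
      ∫ x, w x ^ 2 ∂(sphereMeasure d) := by
  have hm := memLp_homGrad hw hp
  have hi := integrable_norm_sq_of_L2 hG.memLp_grad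
  have hi2 : Integrable (fun x => ‖homGrad w p (‖x‖⁻¹ • x)‖ ^ 2 + F (r * oneHomExt w x))
      (volume.restrict (ball 0 1)) := hi.add hF
  have hi3 : Integrable (fun x => w x ^ 2 + ‖p x‖ ^ 2) (sphereMeasure d) :=
    hw.integrable_sq.add (integrable_norm_sq_of_L2 hp)
  rw [hG.weissW_eq, integral_add hi2 hQ, integral_add hi hF,
    integral_ball_normalize hd (f := fun θ => ‖homGrad w p θ‖ ^ 2) (hm.1.norm.pow 2)]
  congr 4
  rw [← integral_add hw.integrable_sq (integrable_norm_sq_of_L2 hp),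
    ← integral_sub hi3 (memLp_inner_sphere hp).integrable_sq]
  refine integral_congr_ae ?_
  filter_upwards [ae_norm_sphereMeasure d] with x hx
  rw [norm_homGrad_sq w p hx, real_inner_comm]

/-- Here `P = r^(d-1)`, and `E`, `M` are the integrals over `B_r` of the two densities. On the unit
sphere, with `w = u_r` and `p` its gradient, `A`, `N`, `B`, `C` are the integrals of `w²`, `|p|²`,
`w (x·p)`, `(x·p)²`. `SF`, `SQ` are the sphere integrals of the `F` and `Q` terms, and `BF`, `BQ`
the ball integrals of those terms for the one-homogeneous extension. The left side is the product
rule; `hM` identifies `M` with the boundary term, and `C` cancels on the right. -/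
lemma weiss_derivative_algebra {d P r E M N A B C SF SQ BF BQ : ℝ} (hr : r ≠ 0) (hP : P ≠ 0)
    (hd : d ≠ 0) (hM : A = (P * r ^ 3)⁻¹ * M) :
    -(d * P) / (P * r) ^ 2 * E + (P * r)⁻¹ * (P * (N + SF + SQ)) -
      (-((d + 2) * (P * r ^ 2)) / (P * r ^ 3) ^ 2 * M +
        (P * r ^ 3)⁻¹ * (P * (r ^ 2 * (d * A + 2 * B)))) =
    d / r * ((1 / d * (A + N - C) + BF + BQ - A) - ((P * r)⁻¹ * E - A)) +
      1 / r * (C - 2 * B + A) + (1 / r * SF - d / r * BF) + (1 / r * SQ - d / r * BQ) := by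
  have hM' : M = P * r ^ 3 * A := by
    rw [hM]
    field_simp
  rw [hM']
  field_simp
  ring

/-- The derivative of the Weiss energy at a scale where the restrictions to the sphere are
traces and the integrals over balls are differentiable. -/
lemma hasDerivAt_weissW {d : ℕ} [Nontrivial (Eu d)] (hd : 0 < d) {R : ℝ} {u : Eu d → ℝ}
    {x₀ : Eu d} {G : Eu d → Eu d}
    (hv : MemLp (fun y => u (x₀ + y)) 2 (volume.restrict (ball 0 R)))
    (hg : MemLp (fun y => G (x₀ + y)) 2 (volume.restrict (ball 0 R)))
    (h : HasWeakGrad (ball 0 R) (fun y => u (x₀ + y)) (fun y => G (x₀ + y)))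
    {F : ℝ → ℝ} {Q : Eu d → ℝ} {r : ℝ} (hr : r ∈ Ioo 0 R)
    (hE : HasDerivAt (fun ρ => ∫ x in ball 0 ρ,
        energyDensity F (fun y => Q (x₀ + y)) (fun y => u (x₀ + y)) (fun y => G (x₀ + y)) x)
      (r ^ (d - 1) * ∫ θ, energyDensity F (fun y => Q (x₀ + y)) (fun y => u (x₀ + y))
        (fun y => G (x₀ + y)) (r • θ) ∂(sphereMeasure d)) r)
    (hM : HasDerivAt (fun ρ => ∫ x in ball 0 ρ,
        traceDensity (fun y => u (x₀ + y)) (fun y => G (x₀ + y)) x)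
      (r ^ (d - 1) * ∫ θ, traceDensity (fun y => u (x₀ + y))
        (fun y => G (x₀ + y)) (r • θ) ∂(sphereMeasure d)) r)
    (hw : MemLp (rescale x₀ r u) 2 (sphereMeasure d))
    (hp : MemLp (fun x => G (x₀ + r • x)) 2 (sphereMeasure d))
    (hG₁ : GreenTriple (rescale x₀ r u) (fun x => G (x₀ + r • x)) (rescale x₀ r u))
    (hG₂ : GreenTriple (oneHomExt (rescale x₀ r u))
      (fun x => homGrad (rescale x₀ r u) (fun x => G (x₀ + r • x)) (‖x‖⁻¹ • x)) (rescale x₀ r u))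
    (hF₁ : Integrable (fun x => F (r * rescale x₀ r u x)) (sphereMeasure d))
    (hQ₁ : Integrable ({y : Eu d | 0 < rescale x₀ r u y}.indicator fun y => Q (x₀ + r • y) ^ 2)
      (sphereMeasure d))
    (hF₂ : IntegrableOn (fun x => F (r * oneHomExt (rescale x₀ r u) x)) (ball 0 1))
    (hQ₂ : IntegrableOn ({y : Eu d | 0 < oneHomExt (rescale x₀ r u) y}.indicator
      fun y => Q (x₀ + r • y) ^ 2) (ball 0 1)) :
    HasDerivAt (fun ρ : ℝ => weissW F Q x₀ ρ (rescale x₀ ρ u))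
      (d / r * (weissW F Q x₀ r (oneHomExt (rescale x₀ r u)) -
          weissW F Q x₀ r (rescale x₀ r u)) +
        1 / r * (∫ x, |inner ℝ x (G (x₀ + r • x)) - rescale x₀ r u x| ^ 2 ∂(sphereMeasure d)) +
        corrF F r (rescale x₀ r u) + corrQ Q x₀ r (rescale x₀ r u)) r := by
  set w := rescale x₀ r u with hwdef
  set p : Eu d → Eu d := fun x => G (x₀ + r • x) with hpdef
  have hr0 : r ≠ 0 := hr.1.ne'
  have hip := memLp_inner_sphere hp
  have hwp : Integrable (fun x => 2 * (w x * inner ℝ x (p x))) (sphereMeasure d) :=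
    (hw.integrable_mul hip).const_mul 2
  -- the integrals over the sphere
  have hSE : ∫ θ, energyDensity F (fun y => Q (x₀ + y)) (fun y => u (x₀ + y))
      (fun y => G (x₀ + y)) (r • θ) ∂(sphereMeasure d) =
      (∫ x, ‖p x‖ ^ 2 ∂(sphereMeasure d)) + (∫ x, F (r * w x) ∂(sphereMeasure d)) +
      ∫ x, {y : Eu d | 0 < w y}.indicator (fun y => Q (x₀ + r • y) ^ 2) x ∂(sphereMeasure d) := by
    have h1 : Integrable (fun x => ‖p x‖ ^ 2 + F (r * w x)) (sphereMeasure d) :=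
      (integrable_norm_sq_of_L2 hp).add hF₁
    rw [← integral_add (integrable_norm_sq_of_L2 hp) hF₁, ← integral_add h1 hQ₁]
    exact integral_congr_ae (ae_of_all _ fun x => (rescaled_energyDensity F
      (fun y => Q (x₀ + y)) (fun y => u (x₀ + y)) (fun y => G (x₀ + y)) hr.1 x).symm)
  have hSM : ∫ θ, traceDensity (fun y => u (x₀ + y)) (fun y => G (x₀ + y)) (r • θ)
      ∂(sphereMeasure d) =
      r ^ 2 * (d * (∫ x, w x ^ 2 ∂(sphereMeasure d)) +
        2 * ∫ x, w x * inner ℝ x (p x) ∂(sphereMeasure d)) := by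
    rw [← integral_const_mul, ← integral_const_mul,
      ← integral_add (hw.integrable_sq.const_mul _) hwp,
      ← integral_const_mul]
    refine integral_congr_ae (ae_of_all _ fun x => ?_)
    have h1 := rescaled_traceDensity (fun y => u (x₀ + y)) (fun y => G (x₀ + y)) hr.1 x
    have h2 : traceDensity (fun y => u (x₀ + y)) (fun y => G (x₀ + y)) (r • x) =
        r ^ 2 * (d * w x ^ 2 + 2 * w x * inner ℝ (p x) x) := by
      rw [eq_comm, inv_mul_eq_iff_eq_mul₀ (by positivity)] at h1
      exact h1
    rw [real_inner_comm] at h2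
    beta_reduce
    rw [h2]
    ring
  have hC : ∫ x, |inner ℝ x (G (x₀ + r • x)) - w x| ^ 2 ∂(sphereMeasure d) =
      (∫ x, inner ℝ x (p x) ^ 2 ∂(sphereMeasure d)) -
        2 * (∫ x, w x * inner ℝ x (p x) ∂(sphereMeasure d)) +
        ∫ x, w x ^ 2 ∂(sphereMeasure d) := by
    have h1 : Integrable (fun x => inner ℝ x (p x) ^ 2 - 2 * (w x * inner ℝ x (p x)))
        (sphereMeasure d) := hip.integrable_sq.sub hwp
    rw [← integral_const_mul, ← integral_sub hip.integrable_sq hwp,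
      ← integral_add h1 hw.integrable_sq]
    refine integral_congr_ae (ae_of_all _ fun x => ?_)
    simp only [sq_abs, hpdef]
    ring
  have hWr := weissW_rescale_eq hv hg h F Q hr
  -- the square of the trace at the scale `r`
  have hA : ∫ x, w x ^ 2 ∂(sphereMeasure d) = (r ^ (d - 1) * r ^ 3)⁻¹ *
      ∫ x in ball 0 r, traceDensity (fun y => u (x₀ + y)) (fun y => G (x₀ + y)) x := by
    obtain ⟨T, hT, hT'⟩ := exists_greenTriple_rescale hv hg h hr
    have h1 := hT.trace_ae_eq hG₁
    have h2 : ∫ x, w x ^ 2 ∂(sphereMeasure d) = ∫ x, T x ^ 2 ∂(sphereMeasure d) := by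
      refine integral_congr_ae ?_
      filter_upwards [h1] with x hx
      rw [hx]
    rw [h2, hT']
    simp only [rescaled_traceDensity (fun y => u (x₀ + y)) (fun y => G (x₀ + y)) hr.1]
    rw [integral_const_mul, integral_ball_scale hr.1 (traceDensity _ _), ← mul_assoc, ← mul_inv]
    congr 2
    rw [← pow_add, ← pow_add]
    congr 1
    omega
  -- All powers are written through `r^(d-1)`, the power in the polar Jacobian; `0 < d` makes the
  -- subtraction genuine.
  have hpd : r ^ d = r ^ (d - 1) * r := by rw [← pow_succ, Nat.sub_add_cancel hd]
  have hpd2 : r ^ (d + 2) = r ^ (d - 1) * r ^ 3 := by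
    rw [← pow_add]
    congr 1
    omega
  have hpd1 : r ^ (d + 1) = r ^ (d - 1) * r ^ 2 := by
    rw [← pow_add]
    congr 1
    omega
  have hder := (((hasDerivAt_pow d r).inv (pow_ne_zero d hr0)).mul hE).sub
    (((hasDerivAt_pow (d + 2) r).inv (pow_ne_zero (d + 2) hr0)).mul hM)
  refine (hder.congr_of_eventuallyEq ?_).congr_deriv ?_
  -- Differentiability at `r` needs the ball formula at every nearby scale, not just at almost every
  -- one.
  · filter_upwards [Ioo_mem_nhds hr.1 hr.2] with ρ hρ
    exact weissW_rescale_eq hv hg h F Q hρ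
  · rw [weissW_oneHomExt_eq hd hw hp hG₂ hF₂ hQ₂, hC, corrF_eq, corrQ_eq, hSE, hSM, hWr]
    rw [hpd2, ← hA, show d + 2 - 1 = d + 1 from rfl, hpd1, hpd]
    simp only [Pi.inv_apply]
    rw [hpd, hpd2]
    push_cast
    exact weiss_derivative_algebra hr0 (pow_ne_zero _ hr0) (by exact_mod_cast hd.ne') hA

/-! ### Integrability of the densities -/

lemma IsCoefficient.continuousOn {d : ℕ} {Ω : Set (Eu d)} {Q : Eu d → ℝ} {β : ℝ≥0} {Qmin Qmax : ℝ}
    (hQ : IsCoefficient Ω Q β Qmin Qmax) (hβ : 0 < β) : ContinuousOn Q Ω := by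
  obtain ⟨C, hC⟩ := hQ.holder
  exact (hC.continuousOn hβ).mono subset_closure

lemma IsCoefficient.norm_sq_le {d : ℕ} {Ω : Set (Eu d)} {Q : Eu d → ℝ} {β : ℝ≥0}
    {Qmin Qmax : ℝ} (hQ : IsCoefficient Ω Q β Qmin Qmax) {x : Eu d} (hx : x ∈ Ω) :
    ‖Q x ^ 2‖ ≤ Qmax ^ 2 := by
  obtain ⟨h1, h2⟩ := hQ.bounds x (subset_closure hx)
  have h0 := hQ.pos
  rw [Real.norm_of_nonneg (sq_nonneg _)]
  exact pow_le_pow_left₀ (by linarith) h2 2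

lemma integrableOn_energyDensity {d : ℕ} {Ω : Set (Eu d)} {F : ℝ → ℝ} {β : ℝ≥0} {F₀ : ℝ}
    (hF : IsNonlinearity F β F₀) {Q : Eu d → ℝ} {Qmin Qmax : ℝ}
    (hQ : IsCoefficient Ω Q β Qmin Qmax) (hβ : 0 < β) {x₀ : Eu d} {R : ℝ}
    (hR : ball x₀ R ⊆ Ω) {v : Eu d → ℝ} {g : Eu d → Eu d}
    (hv : MemLp v 2 (volume.restrict (ball 0 R))) (hg : MemLp g 2 (volume.restrict (ball 0 R))) :
    IntegrableOn (energyDensity F (fun y => Q (x₀ + y)) v g) (ball 0 R) := by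
  have := isFiniteMeasure_restrict_ball d R
  have hm : MapsTo (fun y => x₀ + y) (ball 0 R) Ω := fun y hy => hR (by simpa using hy)
  refine ((integrable_norm_sq_of_L2 hg).add (hF.integrable_comp hv)).add
    (integrable_indicator_pos hv.1 (C := Qmax ^ 2) ?_ ?_)
  · exact (((hQ.continuousOn hβ).comp (by fun_prop) hm).pow 2).aestronglyMeasurable
      measurableSet_ball
  · filter_upwards [ae_restrict_mem measurableSet_ball] with y hy
    exact hQ.norm_sq_le (hm hy)

lemma integrableOn_traceDensity {d : ℕ} {R : ℝ} {v : Eu d → ℝ} {g : Eu d → Eu d}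
    (hv : MemLp v 2 (volume.restrict (ball 0 R))) (hg : MemLp g 2 (volume.restrict (ball 0 R))) :
    IntegrableOn (traceDensity v g) (ball 0 R) := by
  have h1 : MemLp (fun y => inner ℝ (g y) y) 2 (volume.restrict (ball 0 R)) := by
    refine (hg.const_smul R).mono (hg.1.inner aestronglyMeasurable_id) ?_
    filter_upwards [ae_restrict_mem measurableSet_ball] with y hy
    have hy' : ‖y‖ < R := by simpa using hy
    have hR : 0 ≤ R := (norm_nonneg y).trans hy'.le
    rw [Pi.smul_apply, norm_smul, Real.norm_of_nonneg hR, mul_comm]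
    exact (norm_inner_le_norm _ _).trans (by gcongr)
  have h2 : Integrable (fun y => 2 * (v y * inner ℝ (g y) y)) (volume.restrict (ball 0 R)) :=
    (hv.integrable_mul h1).const_mul 2
  refine ((hv.integrable_sq.const_mul (d : ℝ)).add h2).congr (ae_of_all _ fun y => ?_)
  simp only [traceDensity, Pi.add_apply, mul_assoc]

end

/-! ### The derivative of the Weiss energy at almost every radius. -/

theorem mainTheorem4 {d : ℕ} (hd : 2 ≤ d)
    (Ω S : Set (Eu d)) (hΩ : IsBoundedLipschitzDomain Ω)
    (α β : ℝ≥0) (hα₀ : 0 < α) (hα₁ : α < 1) (hβ₀ : 0 < β) (hβ₁ : β < 1)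
    (F : ℝ → ℝ) (F₀ : ℝ) (hF : IsNonlinearity F β F₀)
    (Q : Eu d → ℝ) (Qmin Qmax : ℝ) (hQ : IsCoefficient Ω Q β Qmin Qmax)
    (Ψ u₀ : Eu d → ℝ) (hS : IsBoundaryData Ω S F Ψ u₀ α)
    (x₀ : Eu d) (hx₀ : x₀ ∈ Ω)
    (u : Eu d → ℝ)
    (hu : IsLocalMinimizer Ω S F Q Ψ u₀ (ball x₀ (infDist x₀ (frontier Ω))) u)
    (G : Eu d → Eu d) (hG : HasWeakGrad Ω u G) :
    ∀ᵐ r : ℝ, r ∈ Ioo 0 (infDist x₀ (frontier Ω)) →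
      MemH1 (ball 0 1) (rescale x₀ r u) ∧
      MemH1 (ball 0 1) (oneHomExt (rescale x₀ r u)) ∧
      Integrable (fun x : sphere (0 : Eu d) 1 =>
        |inner ℝ (x : Eu d) (G (x₀ + r • (x : Eu d))) - rescale x₀ r u x| ^ 2) (surf d) ∧
      Integrable (fun x : sphere (0 : Eu d) 1 => F (r * rescale x₀ r u x)) (surf d) ∧
      Integrable (fun x : sphere (0 : Eu d) 1 =>
        {y : Eu d | 0 < rescale x₀ r u y}.indicator (fun y => Q (x₀ + r • y) ^ 2) (x : Eu d))
        (surf d) ∧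
      HasDerivAt (fun ρ : ℝ => weissW F Q x₀ ρ (rescale x₀ ρ u))
        (d / r * (weissW F Q x₀ r (oneHomExt (rescale x₀ r u)) -
            weissW F Q x₀ r (rescale x₀ r u)) +
          1 / r * (∫ x : sphere (0 : Eu d) 1,
            |inner ℝ (x : Eu d) (G (x₀ + r • (x : Eu d))) - rescale x₀ r u x| ^ 2 ∂(surf d)) +
          corrF F r (rescale x₀ r u) + corrQ Q x₀ r (rescale x₀ r u)) r := by
  set δ := infDist x₀ (frontier Ω) with hδ
  have hball : ball x₀ δ ⊆ Ω := ball_infDist_frontier_subset hΩ.isOpen hx₀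
  have hd0 : 0 < d := by omega
  have : Nontrivial (Eu d) :=
    Module.nontrivial_of_finrank_pos (R := ℝ) (by rwa [finrank_euclideanSpace_fin])
  have := isFiniteMeasure_restrict_ball d δ
  have := isFiniteMeasure_restrict_ball d 1
  obtain ⟨hum, G', hGm', hG'⟩ := hu.1.1
  -- The given representative `G` is only locally integrable by definition; its square integrability
  -- comes from uniqueness of the weak gradient.
  have hGm : MemLp G 2 (volume.restrict Ω) := hGm'.ae_eq (HasWeakGrad.ae_eq hΩ.isOpen hG' hG)
  have hv : MemLp (fun y => u (x₀ + y)) 2 (volume.restrict (ball 0 δ)) :=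
    (hum.mono_measure (Measure.restrict_mono hball le_rfl)).comp_measurePreserving
      (measurePreserving_translate_ball x₀ δ)
  have hg : MemLp (fun y => G (x₀ + y)) 2 (volume.restrict (ball 0 δ)) :=
    (hGm.mono_measure (Measure.restrict_mono hball le_rfl)).comp_measurePreserving
      (measurePreserving_translate_ball x₀ δ)
  have h := hG.translate hball (hv.integrable one_le_two) (hg.integrable one_le_two)
  -- Three null sets of radii are discarded: those where the restriction may fail to be the trace,
  -- and those where one of the two ball integrals may fail to be differentiable.
  filter_upwards [ae_greenTriple hd0 hv hg h,
    hasDerivAt_integral_ball (integrableOn_energyDensity hF hQ hβ₀ hball hv hg),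
    hasDerivAt_integral_ball (integrableOn_traceDensity hv hg)] with r h1 hE hM hr
  obtain ⟨hw, hp, hG₁, hG₂⟩ := h1 hr
  change MemLp (rescale x₀ r u) 2 (sphereMeasure d) at hw
  change GreenTriple (rescale x₀ r u) (fun x => G (x₀ + r • x)) (rescale x₀ r u) at hG₁
  change GreenTriple (oneHomExt (rescale x₀ r u))
    (fun x => homGrad (rescale x₀ r u) (fun x => G (x₀ + r • x)) (‖x‖⁻¹ • x))
    (rescale x₀ r u) at hG₂
  have hmem : ∀ y : Eu d, ‖y‖ ≤ 1 → x₀ + r • y ∈ Ω := fun y hy => hball <| by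
    rw [mem_ball, dist_eq_norm, add_sub_cancel_left, norm_smul, Real.norm_of_nonneg hr.1.le]
    exact (mul_le_of_le_one_right hr.1.le hy).trans_lt hr.2
  have hq : ContinuousOn (fun y => Q (x₀ + r • y) ^ 2) (closedBall 0 1) :=
    ((hQ.continuousOn hβ₀).comp (by fun_prop) fun y hy => hmem y (by simpa using hy)).pow 2
  -- The coefficient is known to be continuous only near the domain; as the surface measure is
  -- carried by the closed unit ball, continuity there is enough for measurability.
  have hσ : (sphereMeasure d).restrict (closedBall 0 1) = sphereMeasure d :=
    Measure.restrict_eq_self_of_ae_mem <| by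
      filter_upwards [ae_norm_sphereMeasure d] with x hx
      simp [hx]
  have hF₁ : Integrable (fun x => F (r * rescale x₀ r u x)) (sphereMeasure d) :=
    hF.integrable_comp (hw.const_mul r)
  have hF₂ : IntegrableOn (fun x => F (r * oneHomExt (rescale x₀ r u) x)) (ball 0 1) :=
    hF.integrable_comp (hG₂.memLp.const_mul r)
  have hQ₁ : Integrable
      ({y : Eu d | 0 < rescale x₀ r u y}.indicator fun y => Q (x₀ + r • y) ^ 2)
      (sphereMeasure d) := by
    refine integrable_indicator_pos hw.1 (C := Qmax ^ 2) ?_ ?_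
    · rw [← hσ]
      exact hq.aestronglyMeasurable measurableSet_closedBall
    · filter_upwards [ae_norm_sphereMeasure d] with x hx
      exact hQ.norm_sq_le (hmem x hx.le)
  have hQ₂ : IntegrableOn ({y : Eu d | 0 < oneHomExt (rescale x₀ r u) y}.indicator
      fun y => Q (x₀ + r • y) ^ 2) (ball 0 1) := by
    refine integrable_indicator_pos hG₂.memLp.1 (C := Qmax ^ 2) ?_ ?_
    · exact (hq.mono ball_subset_closedBall).aestronglyMeasurable measurableSet_ball
    · filter_upwards [ae_restrict_mem measurableSet_ball] with x hx
      exact hQ.norm_sq_le (hmem x (by simpa using (mem_ball_zero_iff.1 hx).le))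
  have hS₁ : Integrable (fun x => |inner ℝ x (G (x₀ + r • x)) - rescale x₀ r u x| ^ 2)
      (sphereMeasure d) := by
    simp only [sq_abs]
    exact ((memLp_inner_sphere hp).sub hw).integrable_sq
  refine ⟨hG₁.memH1, hG₂.memH1, integrable_sphereMeasure_iff.1 hS₁,
    integrable_sphereMeasure_iff.1 hF₁, integrable_sphereMeasure_iff.1 hQ₁, ?_⟩
  rw [← integral_sphereMeasure
    (fun x => |inner ℝ x (G (x₀ + r • x)) - rescale x₀ r u x| ^ 2)]
  exact hasDerivAt_weissW hd0 hv hg h hr (hE hr) (hM hr) hw hp hG₁ hG₂ hF₁ hQ₁ hF₂ hQ₂
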